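/- Let $n\ge 1$. A monotone triangle with $n$ rows is a triangular array $(a_{i,j})_{1\le j\le i\le n}$ of integers such that $a_{i,j}\le a_{i-1,j}\le a_{i,j+1}$ and $a_{i,j}<a_{i,j+1}$ for all $i,j$ for which the entries are defined; its bottom row is $(a_{n,1},\dots,a_{n,n})$. It is strictly increasing in southeast direction if $a_{i-1,j}<a_{i,j+1}$ for all $i,j$. On $\mathbb{C}[k_1,\dots,k_n]$ let $E_{k_i}$ be the shift operator $k_i\mapsto k_i+1$ and $\Delta_{k_i}=E_{k_i}-\operatorname{id}$. All these operators commute, and products of operators are compositions. Extend $\sum_{i=a}^{b} f(i)$ to all $a,b\in\mathbb{Z}$ by $0$ if $b=a-1$ and by $-\sum_{i=b+1}^{a-1} f(i)$ if $b<a-1$. Define $\alpha(n;k_1,\dots,k_n)$ for all $(k_1,\dots,k_n)\in\mathbb{Z}^n$ by $\alpha(1;k_1)=1$ and $\alpha(n;k_1,\dots,k_n)=\sum_{(l_1,\dots,l_{n-1})}^{(k_1,\dots,k_n)}\alpha(n-1;l_1,\dots,l_{n-1})$, where $\sum_{(l_1)}^{(k_1,k_2)}A(l_1)=\sum_{l_1=k_1}^{k_2}A(l_1)$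 and, for $n>2$, $$\sum_{(l_1,\dots,l_{n-1})}^{(k_1,\dots,k_n)}A(l_1,\dots,l_{n-1})=\sum_{(l_1,\dots,l_{n-2})}^{(k_1,\dots,k_{n-1})}\ \sum_{l_{n-1}=k_{n-1}+1}^{k_n}A(l_1,\dots,l_{n-1})+\sum_{(l_1,\dots,l_{n-2})}^{(k_1,\dots,k_{n-2},k_{n-1}-1)}A(l_1,\dots,l_{n-2},k_{n-1}).$$ Theorem. (a) For all $1\le p<q\le n$ the operator $\operatorname{id}+E_{k_q}\Delta_{k_p}$ on $\mathbb{C}[k_1,\dots,k_n]$ is invertible. For all integers $k_1<k_2<\dots<k_n$ the number of monotone triangles with $n$ rows and bottom row $(k_1,\dots,k_n)$ is the value at $(k_1,\dots,k_n)$ of the polynomial $$\Bigl(\prod_{1\le p<q\le n}(\operatorname{id}+E_{k_q}\Delta_{k_p})^{-1}\Bigr)\prod_{1\le i<j\le n}\frac{k_j-k_i}{j-i},$$ and for all $(k_1,\dots,k_n)\in\mathbb{Z}^n$ the value of this polynomial is $\alpha(n;k_1,\dots,k_n)$. (b) Equivalently: there is exactly one polynomial in $\mathbb{C}[k_1,\dots,k_n]$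 whose value at every strictly increasing integer tuple is the number of monotone triangles with that bottom row; it agrees with $\alpha(n;\cdot)$ on all of $\mathbb{Z}^n$, and, writing $\alpha$ for this polynomial, $$\Bigl(\prod_{1\le p<q\le n}(\operatorname{id}+E_{k_q}\Delta_{k_p})\Bigr)\alpha=\prod_{1\le i<j\le n}\frac{k_j-k_i}{j-i}.$$ At every integer tuple $k_1<\dots<k_n$ the value of this image is the number of monotone triangles with bottom row $(k_1,\dots,k_n)$ that are strictly increasing in southeast direction. If moreover $k_1\ge 1$, this value is also the number of semistandard tableaux of shape $(k_n-n,k_{n-1}-(n-1),\dots,k_1-1)$ with entries in $\{1,\dots,n\}$. -/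

import Mathlib

/-! ### Operators on polynomials in `k_1, …, k_n` -/

namespace MonTri

open MvPolynomial

/-- The shift operator `E_{k_i}` on `ℂ[k_1, …, k_n]`: it replaces the variable `k_i` by `k_i + 1`
and leaves the other variables alone. -/
noncomputable def shift {n : ℕ} (i : Fin n) : Module.End ℂ (MvPolynomial (Fin n) ℂ) :=
  (aeval (fun j : Fin n =>
    if j = i then (X j + 1 : MvPolynomial (Fin n) ℂ) else X j)).toLinearMap

/-- The difference operator `Δ_{k_i} = E_{k_i} - id`. -/
noncomputable def diff {n : ℕ} (i : Fin n) : Module.End ℂ (MvPolynomial (Fin n) ℂ) :=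
  shift i - 1

/-- The operator `id + E_{k_q} Δ_{k_p}`, for the pair `x = (p, q)`. -/
noncomputable def factor {n : ℕ} (x : Fin n × Fin n) :
    Module.End ℂ (MvPolynomial (Fin n) ℂ) :=
  1 + shift x.2 * diff x.1

theorem shift_commute {n : ℕ} (i j : Fin n) : Commute (shift i) (shift j) := by
  have h : (aeval (fun l : Fin n =>
        if l = i then (X l + 1 : MvPolynomial (Fin n) ℂ) else X l)).comp
      (aeval (fun l : Fin n =>
        if l = j then (X l + 1 : MvPolynomial (Fin n) ℂ) else X l)) =
      (aeval (fun l : Fin n =>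
        if l = j then (X l + 1 : MvPolynomial (Fin n) ℂ) else X l)).comp
      (aeval (fun l : Fin n =>
        if l = i then (X l + 1 : MvPolynomial (Fin n) ℂ) else X l)) := by
    apply MvPolynomial.algHom_ext
    intro l
    by_cases hi : l = i <;> by_cases hj : l = j <;> simp [hi, hj] <;> split_ifs <;> simp_all
  apply LinearMap.ext
  intro P
  exact DFunLike.congr_fun h P

theorem factor_commute {n : ℕ} (x y : Fin n × Fin n) : Commute (factor x) (factor y) := by
  have hsd : ∀ i j : Fin n, Commute (shift i) (diff j) := fun i j =>
    (shift_commute i j).sub_right (Commute.one_right _)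
  have hdd : ∀ i j : Fin n, Commute (diff i) (diff j) := fun i j =>
    (hsd i j).sub_left (Commute.one_left _)
  have h : Commute (shift x.2 * diff x.1) (shift y.2 * diff y.1) :=
    ((shift_commute _ _).mul_right (hsd _ _)).mul_left ((hsd _ _).symm.mul_right (hdd _ _))
  exact (Commute.one_left _).add_left ((Commute.one_right _).add_right h)

/-- The pairs `(p, q)` with `p < q`. -/
def pairs (n : ℕ) : Finset (Fin n × Fin n) :=
  Finset.univ.filter (fun x => x.1 < x.2)

/-- The composition `∏_{p < q} (id + E_{k_q} Δ_{k_p})`. The factors commute, so the order of the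
composition does not matter. -/
noncomputable def prodOp (n : ℕ) : Module.End ℂ (MvPolynomial (Fin n) ℂ) :=
  (pairs n).noncommProd factor (fun x _ y _ _ => factor_commute x y)

/-- The composition `∏_{p < q} (id + E_{k_q} Δ_{k_p})⁻¹` of the inverses. (`Ring.inverse` is the
inverse of a unit, and `0` on non-units.) -/
noncomputable def prodInvOp (n : ℕ) : Module.End ℂ (MvPolynomial (Fin n) ℂ) :=
  (pairs n).noncommProd (fun x => Ring.inverse (factor x))
    (fun x _ y _ _ => (factor_commute x y).ringInverse_ringInverse)

/-- The polynomial `∏_{i < j} (k_j - k_i) / (j - i)`. -/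
noncomputable def vandermonde (n : ℕ) : MvPolynomial (Fin n) ℂ :=
  ∏ x ∈ pairs n, C (((x.2 : ℕ) : ℂ) - ((x.1 : ℕ) : ℂ))⁻¹ * (X x.2 - X x.1)

/-- The value of a polynomial at an integer point. -/
noncomputable def evalInt {n : ℕ} (k : Fin n → ℤ) (P : MvPolynomial (Fin n) ℂ) : ℂ :=
  eval (fun i => (k i : ℂ)) P

/-! ### Monotone triangles -/

/-- A monotone triangle with `n` rows: integers `a_{i,j}`, `1 ≤ j ≤ i ≤ n`, with
`a_{i+1,j} ≤ a_{i,j} ≤ a_{i+1,j+1}` and strictly increasing rows. The entry function is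
normalised to `0` outside the index range. -/
@[ext] structure MonotoneTriangle (n : ℕ) where
  entry : ℕ → ℕ → ℤ
  northeast : ∀ i j, 1 ≤ j → j ≤ i → i + 1 ≤ n → entry (i + 1) j ≤ entry i j
  southeast : ∀ i j, 1 ≤ j → j ≤ i → i + 1 ≤ n → entry i j ≤ entry (i + 1) (j + 1)
  row_strict : ∀ i j, 1 ≤ j → j + 1 ≤ i → i ≤ n → entry i j < entry i (j + 1)
  zeros : ∀ i j, ¬ (1 ≤ j ∧ j ≤ i ∧ i ≤ n) → entry i j = 0

/-- The bottom row of `t` is `k`; the `j`-th component of `k` has index `j - 1` in `Fin n`. -/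
def MonotoneTriangle.HasBottomRow {n : ℕ} (t : MonotoneTriangle n) (k : Fin n → ℤ) : Prop :=
  ∀ j : Fin n, t.entry n ((j : ℕ) + 1) = k j

/-- `t` is strictly increasing in southeast direction. -/
def MonotoneTriangle.StrictSoutheast {n : ℕ} (t : MonotoneTriangle n) : Prop :=
  ∀ i j, 1 ≤ j → j ≤ i → i + 1 ≤ n → t.entry i j < t.entry (i + 1) (j + 1)

/-- The number of monotone triangles with `n` rows and bottom row `k`. -/
noncomputable def countMT (n : ℕ) (k : Fin n → ℤ) : ℕ :=
  Nat.card {t : MonotoneTriangle n // t.HasBottomRow k}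

/-- The number of monotone triangles with `n` rows and bottom row `k` that are strictly
increasing in southeast direction. -/
noncomputable def countStrictMT (n : ℕ) (k : Fin n → ℤ) : ℕ :=
  Nat.card {t : MonotoneTriangle n // t.HasBottomRow k ∧ t.StrictSoutheast}

/-- The number of semistandard tableaux of shape `μ` with entries in a fixed `n`-element chain
(here `{0, …, n - 1}`). -/
noncomputable def countSSYT (n : ℕ) (μ : YoungDiagram) : ℕ :=
  Nat.card {T : SemistandardYoungTableau μ // ∀ i j, (i, j) ∈ μ → T i j < n}

/-! ### The extension of the counting function to all integer bottom rows -/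

/-- Extended summation `∑_{i=a}^{b} f(i)`: it is `0` for `b = a - 1`, and
`-f(b+1) - ⋯ - f(a-1)` for `b + 1 ≤ a - 1`. -/
noncomputable def extSum (a b : ℤ) (f : ℤ → ℤ) : ℤ :=
  if a ≤ b then ∑ i ∈ Finset.Icc a b, f i else - ∑ i ∈ Finset.Icc (b + 1) (a - 1), f i

/-- The extended summation operator `∑_{(l_1,…,l_n)}^{(k_1,…,k_{n+1})} A(l_1,…,l_n)`, by recursion
on the number of variables. For `k_1 < ⋯ < k_{n+1}` it is the sum over all integer tuples with
`k_1 ≤ l_1 ≤ k_2 ≤ ⋯ ≤ l_n ≤ k_{n+1}` and `l_i ≠ l_{i+1}`. -/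
noncomputable def rowSum : (n : ℕ) → (Fin (n + 1) → ℤ) → ((Fin n → ℤ) → ℤ) → ℤ
  | 0, _, A => A ![]
  | 1, k, A => extSum (k 0) (k 1) (fun l => A ![l])
  | n + 2, k, A =>
    -- `m` is the last but one entry of `k`
    let m : ℤ := k (Fin.last (n + 1)).castSucc
    rowSum (n + 1) (Fin.init k)
        (fun l => extSum (m + 1) (k (Fin.last (n + 2))) (fun x => A (Fin.snoc l x)))
      + rowSum (n + 1) (Function.update (Fin.init k) (Fin.last (n + 1)) (m - 1))
        (fun l => A (Fin.snoc l m))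

/-- The function `α(n; k_1, …, k_n)` on all of `ℤⁿ`. -/
noncomputable def alpha : (n : ℕ) → (Fin n → ℤ) → ℤ
  | 0, _ => 1
  | 1, _ => 1
  | n + 2, k => rowSum (n + 1) k (alpha (n + 1))

end MonTri

/-! Let `ℤ[x_1, …, x_n]` act on functions on `ℤⁿ`, with `x_i` acting as the shift of the `i`-th
coordinate. On functions annihilated by a power of every difference operator (`LocNil`), each factor
`id + E_q Δ_p` is the identity plus a nilpotent operator, so it is inverted by a finite geometric
series. Hence `V_n = ∏_{p<q} (id + E_q Δ_p)`, with symbol `symbProd n`, is bijective on such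
functions. Identities can be proved after applying `V_n`, and symmetries pass through its inverse.

The core is `rowSum_eq_of_act`. If `V_m A = Δ_1 ⋯ Δ_m C` with `C` antisymmetric, then the row sum of
`A` is the locally nilpotent `F` with `V_{m+1} F = E_1 ⋯ E_{m+1} ∑_j ± C(k without k_j)`. Two
properties determine a row sum: its difference in the first coordinate is minus a row sum in one
variable fewer (`rowSum_sub_cons`), and it satisfies a three-term relation at `k_1 = k_2`
(`rowSum_diagonal`). `F` has the first by induction on `m`. It has the second because `V_{m+1}`
without the factor of the first two coordinates is symmetric in them.

For `C = det (k_i choose j + 1)`, with `j` counted from `0`, the differences give `det (k_i choose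
j)`. The alternating sum is the Laplace expansion of the determinant one size larger, which is
invariant under the simultaneous shift. This yields `V_n α = det (k_i choose j)` (`alpha_spec`), and
the right side is the normalised Vandermonde product (`evalInt_vandermonde`).

A polynomial is determined by its values at strictly increasing integer points, so the identity
transfers to `ℂ[k_1, …, k_n]`. The counts follow by removing bottom rows. For triangles strict in
southeast direction the rows above `k` form a box, over which the binomial determinant telescopes.
Tableaux correspond to these triangles through the shapes formed by their entries less than `i`. -/

namespace MonTri

open MvPolynomial

/-! ### Shift operators on functions on `ℤⁿ`, and their inversion on locally nilpotent functions. -/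

variable {M M' : Type*} [AddCommGroup M] [AddCommGroup M']

/-- Translation of functions on `ℤⁿ` by an integer vector with nonnegative coordinates. -/
def translate (M : Type*) [AddCommGroup M] (n : ℕ) :
    Multiplicative (Fin n →₀ ℕ) →* Module.End ℤ ((Fin n → ℤ) → M) where
  toFun v :=
    { toFun := fun f k => f (fun i => k i + (Multiplicative.toAdd v i : ℕ))
      map_add' := fun _ _ => rfl
      map_smul' := fun _ _ => rfl }
  map_one' := by
    ext f k
    simp
  map_mul' v w := by
    ext f k
    simp [add_assoc]

/-- The action of `ℤ[x_1, …, x_n]` on functions on `ℤⁿ`, where `x_i` acts as the shift of the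
`i`-th coordinate, as a homomorphism of algebras. -/
noncomputable def actHom (M : Type*) [AddCommGroup M] (n : ℕ) :
    MvPolynomial (Fin n) ℤ →ₐ[ℤ] Module.End ℤ ((Fin n → ℤ) → M) :=
  AddMonoidAlgebra.lift ℤ (Module.End ℤ ((Fin n → ℤ) → M)) (Fin n →₀ ℕ) (translate M n)

/-- The action of `ℤ[x_1, …, x_n]` on functions on `ℤⁿ`, where `x_i` acts as the shift of the
`i`-th coordinate. -/
noncomputable def act {n : ℕ} (p : MvPolynomial (Fin n) ℤ) (f : (Fin n → ℤ) → M) :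
    (Fin n → ℤ) → M :=
  actHom M n p f

theorem act_X {n : ℕ} (i : Fin n) (f : (Fin n → ℤ) → M) (k : Fin n → ℤ) :
    act (X i) f k = f (Function.update k i (k i + 1)) := by
  have : actHom M n (X i) = translate M n (Multiplicative.ofAdd (Finsupp.single i 1)) := by
    unfold actHom
    erw [AddMonoidAlgebra.lift_single]
    simp
  rw [act, this]
  simp only [translate, MonoidHom.coe_mk, OneHom.coe_mk, LinearMap.coe_mk, AddHom.coe_mk,
    toAdd_ofAdd]
  congr 1
  funext j
  by_cases h : j = i
  · subst h; simp
  · simp [h]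

theorem act_add {n : ℕ} (p : MvPolynomial (Fin n) ℤ) (f g : (Fin n → ℤ) → M) :
    act p (f + g) = act p f + act p g := map_add (actHom M n p) f g

theorem act_sub {n : ℕ} (p : MvPolynomial (Fin n) ℤ) (f g : (Fin n → ℤ) → M) :
    act p (f - g) = act p f - act p g := map_sub (actHom M n p) f g

theorem act_neg {n : ℕ} (p : MvPolynomial (Fin n) ℤ) (f : (Fin n → ℤ) → M) :
    act p (-f) = -act p f := map_neg (actHom M n p) f

theorem act_smul {n : ℕ} (p : MvPolynomial (Fin n) ℤ) (c : ℤ) (f : (Fin n → ℤ) → M) :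
    act p (c • f) = c • act p f := map_smul (actHom M n p) c f

theorem act_zero {n : ℕ} (p : MvPolynomial (Fin n) ℤ) :
    act p (0 : (Fin n → ℤ) → M) = 0 := map_zero (actHom M n p)

theorem act_sum {n : ℕ} {ι : Type*} (p : MvPolynomial (Fin n) ℤ) (s : Finset ι)
    (f : ι → (Fin n → ℤ) → M) : act p (∑ a ∈ s, f a) = ∑ a ∈ s, act p (f a) :=
  map_sum (actHom M n p) f s

theorem act_mul_apply {n : ℕ} (p q : MvPolynomial (Fin n) ℤ) (f : (Fin n → ℤ) → M) :
    act (p * q) f = act p (act q f) := by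
  rw [act, map_mul]; rfl

theorem act_comm {n : ℕ} (p q : MvPolynomial (Fin n) ℤ) (f : (Fin n → ℤ) → M) :
    act p (act q f) = act q (act p f) := by
  rw [← act_mul_apply, mul_comm, act_mul_apply]

theorem act_add_apply {n : ℕ} (p q : MvPolynomial (Fin n) ℤ) (f : (Fin n → ℤ) → M) :
    act (p + q) f = act p f + act q f := by
  rw [act, map_add]; rfl

theorem act_sub_apply {n : ℕ} (p q : MvPolynomial (Fin n) ℤ) (f : (Fin n → ℤ) → M) :
    act (p - q) f = act p f - act q f := by
  rw [act, map_sub]; rfl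

theorem act_one_apply {n : ℕ} (f : (Fin n → ℤ) → M) :
    act (1 : MvPolynomial (Fin n) ℤ) f = f := by
  rw [act, map_one]; rfl

theorem act_C {n : ℕ} (a : ℤ) (f : (Fin n → ℤ) → M) :
    act (C a : MvPolynomial (Fin n) ℤ) f = a • f := by
  rw [act, ← algebraMap_eq, AlgHom.commutes]
  rfl

theorem act_intertwine {n m : ℕ} (φ : MvPolynomial (Fin n) ℤ →ₐ[ℤ] MvPolynomial (Fin m) ℤ)
    (T : ((Fin n → ℤ) → M) →ₗ[ℤ] ((Fin m → ℤ) → M'))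
    (h : ∀ i f, T (act (X i) f) = act (φ (X i)) (T f)) (p : MvPolynomial (Fin n) ℤ) :
    ∀ f, T (act p f) = act (φ p) (T f) := by
  induction p using MvPolynomial.induction_on with
  | C a =>
    intro f
    rw [← algebraMap_eq, AlgHom.commutes, algebraMap_eq, algebraMap_eq, act_C, act_C, map_smul]
  | add p q hp hq =>
    intro f
    rw [act_add_apply, map_add, map_add, act_add_apply, hp, hq]
  | mul_X p i hp =>
    intro f
    rw [act_mul_apply, hp, h, map_mul, act_mul_apply]

/-- Pullback of functions along a map of index sets. -/
def pullback {M : Type*} {n m : ℕ} (g : Fin n → Fin m) (f : (Fin n → ℤ) → M) : (Fin m → ℤ) → M :=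
  fun k => f (k ∘ g)

@[simp] theorem pullback_apply {M : Type*} {n m : ℕ} (g : Fin n → Fin m) (f : (Fin n → ℤ) → M)
    (k : Fin m → ℤ) : pullback g f k = f (k ∘ g) := rfl

theorem pullback_act {n m : ℕ} {g : Fin n → Fin m} (hg : Function.Injective g)
    (p : MvPolynomial (Fin n) ℤ) (f : (Fin n → ℤ) → M) :
    pullback g (act p f) = act (rename g p) (pullback g f) := by
  refine act_intertwine (rename g)
    (⟨⟨pullback g, fun _ _ => rfl⟩, fun _ _ => rfl⟩ : _ →ₗ[ℤ] _) (fun i f => ?_) p f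
  change pullback g (act (X i) f) = act _ (pullback g f)
  funext k
  rw [rename_X, act_X, pullback_apply, pullback_apply, act_X]
  congr 1
  rw [Function.update_comp_eq_of_injective _ hg]
  rfl

theorem act_X_pullback {n m : ℕ} {g : Fin n → Fin m} {j : Fin m} (hj : ∀ i, g i ≠ j)
    (f : (Fin n → ℤ) → M) : act (X j) (pullback g f) = pullback g f := by
  funext k
  rw [act_X, pullback_apply, pullback_apply]
  congr 1
  funext i
  simp [hj i]

/-- Restriction of a function to the hyperplane where the first coordinate is `x`. -/
def slice {M : Type*} {n : ℕ} (x : ℤ) (f : (Fin (n + 1) → ℤ) → M) : (Fin n → ℤ) → M :=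
  fun l => f (Fin.cons x l)

@[simp] theorem slice_apply {M : Type*} {n : ℕ} (x : ℤ) (f : (Fin (n + 1) → ℤ) → M)
    (l : Fin n → ℤ) : slice x f l = f (Fin.cons x l) := rfl

theorem slice_act {n : ℕ} (x : ℤ) (p : MvPolynomial (Fin n) ℤ) (f : (Fin (n + 1) → ℤ) → M) :
    act p (slice x f) = slice x (act (rename Fin.succ p) f) := by
  induction p using MvPolynomial.induction_on generalizing f with
  | C a =>
    rw [rename_C, act_C, act_C]
    rfl
  | add p q hp hq =>
    rw [act_add_apply, hp, hq, map_add, act_add_apply]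
    rfl
  | mul_X p i hp =>
    have : act (X i) (slice x f) = slice x (act (X i.succ) f) := by
      funext l
      rw [act_X, slice_apply, slice_apply, act_X, Fin.cons_update]
      simp
    rw [act_mul_apply, this, hp, map_mul, act_mul_apply, rename_X]

/-- Functions that are annihilated by a power of each difference operator. -/
def LocNil {n : ℕ} (f : (Fin n → ℤ) → M) : Prop :=
  ∀ i, ∃ N : ℕ, act ((X i - 1) ^ N) f = 0

theorem LocNil.act {n : ℕ} {f : (Fin n → ℤ) → M} (hf : LocNil f) (p : MvPolynomial (Fin n) ℤ) :
    LocNil (act p f) := fun i => by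
  obtain ⟨N, hN⟩ := hf i
  exact ⟨N, by rw [act_comm, hN, act_zero]⟩

theorem LocNil.zero {n : ℕ} : LocNil (0 : (Fin n → ℤ) → M) := fun _ => ⟨0, act_zero _⟩

theorem LocNil.add {n : ℕ} {f g : (Fin n → ℤ) → M} (hf : LocNil f) (hg : LocNil g) :
    LocNil (f + g) := fun i => by
  obtain ⟨N, hN⟩ := hf i
  obtain ⟨N', hN'⟩ := hg i
  refine ⟨N + N', ?_⟩
  rw [act_add, pow_add, act_mul_apply, act_mul_apply, hN', act_comm, hN, act_zero,
    act_zero, add_zero]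

theorem LocNil.smul {n : ℕ} {f : (Fin n → ℤ) → M} (hf : LocNil f) (c : ℤ) :
    LocNil (c • f) := fun i => by
  obtain ⟨N, hN⟩ := hf i
  exact ⟨N, by rw [act_smul, hN, smul_zero]⟩

theorem LocNil.sub {n : ℕ} {f g : (Fin n → ℤ) → M} (hf : LocNil f) (hg : LocNil g) :
    LocNil (f - g) := by
  have := hf.add (hg.smul (-1))
  rwa [neg_one_smul, ← sub_eq_add_neg] at this

theorem LocNil.sum {n : ℕ} {ι : Type*} (s : Finset ι) {f : ι → (Fin n → ℤ) → M}
    (hf : ∀ a ∈ s, LocNil (f a)) : LocNil (∑ a ∈ s, f a) :=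
  Finset.sum_induction _ _ (fun _ _ => LocNil.add) LocNil.zero hf

theorem LocNil.slice {n : ℕ} {f : (Fin (n + 1) → ℤ) → M} (hf : LocNil f) (x : ℤ) :
    LocNil (slice x f) := fun i => by
  obtain ⟨N, hN⟩ := hf i.succ
  refine ⟨N, ?_⟩
  rw [slice_act, map_pow, map_sub, rename_X, map_one, hN]
  rfl

theorem LocNil.pullback {n m : ℕ} {g : Fin n → Fin m} (hg : Function.Injective g)
    {f : (Fin n → ℤ) → M} (hf : LocNil f) : LocNil (pullback g f) := fun j => by
  by_cases h : ∃ i, g i = j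
  · obtain ⟨i, rfl⟩ := h
    obtain ⟨N, hN⟩ := hf i
    refine ⟨N, ?_⟩
    have := pullback_act hg ((X i - 1) ^ N) f
    rw [map_pow, map_sub, rename_X, map_one] at this
    rw [← this, hN]
    rfl
  · push Not at h
    refine ⟨1, ?_⟩
    rw [pow_one, act_sub_apply, act_X_pullback h, act_one_apply, sub_self]

/-- `p` is invertible on every locally nilpotent function. -/
def InvertibleOn (M : Type*) [AddCommGroup M] {n : ℕ} (p : MvPolynomial (Fin n) ℤ) : Prop :=
  ∀ f : (Fin n → ℤ) → M, LocNil f → ∃ z, act (z * p) f = f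

theorem InvertibleOn.eq_zero {n : ℕ} {p : MvPolynomial (Fin n) ℤ} (hp : InvertibleOn M p)
    {f : (Fin n → ℤ) → M} (hf : LocNil f) (h : act p f = 0) : f = 0 := by
  obtain ⟨z, hz⟩ := hp f hf
  rw [← hz, act_mul_apply, h, act_zero]

theorem InvertibleOn.injective {n : ℕ} {p : MvPolynomial (Fin n) ℤ} (hp : InvertibleOn M p)
    {f g : (Fin n → ℤ) → M} (hf : LocNil f) (hg : LocNil g) (h : act p f = act p g) : f = g :=
  sub_eq_zero.mp (hp.eq_zero (hf.sub hg) (by rw [act_sub, h, sub_self]))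

theorem InvertibleOn.surjective {n : ℕ} {p : MvPolynomial (Fin n) ℤ} (hp : InvertibleOn M p)
    {f : (Fin n → ℤ) → M} (hf : LocNil f) : ∃ g, LocNil g ∧ act p g = f := by
  obtain ⟨z, hz⟩ := hp f hf
  exact ⟨act z f, hf.act z, by rw [← act_mul_apply, mul_comm, hz]⟩

theorem InvertibleOn.one {n : ℕ} : InvertibleOn M (1 : MvPolynomial (Fin n) ℤ) :=
  fun f _ => ⟨1, by rw [mul_one, act_one_apply]⟩

theorem InvertibleOn.mul {n : ℕ} {p q : MvPolynomial (Fin n) ℤ} (hp : InvertibleOn M p)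
    (hq : InvertibleOn M q) : InvertibleOn M (p * q) := fun f hf => by
  obtain ⟨z, hz⟩ := hp f hf
  obtain ⟨w, hw⟩ := hq f hf
  refine ⟨w * z, ?_⟩
  rw [show w * z * (p * q) = w * q * (z * p) by ring, act_mul_apply, hz, hw]

theorem InvertibleOn.prod {n : ℕ} {ι : Type*} (s : Finset ι) {p : ι → MvPolynomial (Fin n) ℤ}
    (hp : ∀ a ∈ s, InvertibleOn M (p a)) : InvertibleOn M (∏ a ∈ s, p a) :=
  Finset.prod_induction _ _ (fun _ _ => InvertibleOn.mul) InvertibleOn.one hp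

/-- The symbol of the operator `id + E_q Δ_p`. -/
noncomputable def symb {n : ℕ} (p q : Fin n) : MvPolynomial (Fin n) ℤ := 1 + X q * (X p - 1)

/-- The `N`-th power of `X q * (X p - 1)` contains `(X p - 1) ^ N`, which kills `f`, so the
geometric series can be cut off at `N`. The inverting polynomial depends on `f`. -/
theorem invertibleOn_symb {n : ℕ} (p q : Fin n) : InvertibleOn M (symb p q) := fun f hf => by
  obtain ⟨N, hN⟩ := hf p
  set u : MvPolynomial (Fin n) ℤ := X q * (X p - 1) with hu
  refine ⟨∑ j ∈ Finset.range N, (-u) ^ j, ?_⟩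
  have h1 : (∑ j ∈ Finset.range N, (-u) ^ j) * symb p q = 1 - (-u) ^ N := by
    have := geom_sum_mul_neg (-u) N
    rwa [sub_neg_eq_add] at this
  have h2 : act ((-u) ^ N) f = 0 := by
    rw [hu, show (-(X q * (X p - 1)) : MvPolynomial (Fin n) ℤ) ^ N
      = (-X q) ^ N * (X p - 1) ^ N by rw [← mul_pow]; ring, act_mul_apply, hN, act_zero]
  rw [h1, act_sub_apply, act_one_apply, h2, sub_zero]

theorem rename_symb {n m : ℕ} (g : Fin n → Fin m) (p q : Fin n) :
    rename g (symb p q) = symb (g p) (g q) := by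
  simp [symb]

/-- The symbol of `∏_{p < q} (id + E_q Δ_p)`. -/
noncomputable def symbProd (n : ℕ) : MvPolynomial (Fin n) ℤ := ∏ x ∈ pairs n, symb x.1 x.2

/-- The symbol of `∏_{q > 0} (id + E_q Δ_0)`. -/
noncomputable def symbZero (n : ℕ) : MvPolynomial (Fin (n + 1)) ℤ := ∏ q : Fin n, symb 0 q.succ

theorem symbProd_eq (n : ℕ) : symbProd n = ∏ p : Fin n, ∏ q : Fin n,
    if p < q then symb p q else 1 := by
  rw [symbProd, pairs, Finset.prod_filter, ← Finset.univ_product_univ, Finset.prod_product]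

/-- Separates the pairs that involve the first coordinate. This is what makes induction on slices
possible. -/
theorem symbProd_succ (n : ℕ) :
    symbProd (n + 1) = symbZero n * rename Fin.succ (symbProd n) := by
  rw [symbProd_eq, Fin.prod_univ_succ]
  congr 1
  · rw [Fin.prod_univ_succ]
    simp [symbZero]
  · rw [symbProd_eq, map_prod]
    refine Finset.prod_congr rfl fun p _ => ?_
    rw [Fin.prod_univ_succ, map_prod]
    simp only [Fin.not_lt_zero, if_false, one_mul, Fin.succ_lt_succ_iff]
    refine Finset.prod_congr rfl fun q _ => ?_
    split_ifs
    · rw [rename_symb]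
    · rw [map_one]

theorem invertibleOn_symbProd (n : ℕ) : InvertibleOn M (symbProd n) :=
  InvertibleOn.prod _ fun _ _ => invertibleOn_symb _ _

theorem invertibleOn_symbZero (n : ℕ) : InvertibleOn M (symbZero n) :=
  InvertibleOn.prod _ fun _ _ => invertibleOn_symb _ _

theorem invertibleOn_rename_symbProd {n m : ℕ} (g : Fin n → Fin m) :
    InvertibleOn M (rename g (symbProd n)) := by
  rw [symbProd, map_prod]
  refine InvertibleOn.prod _ fun _ _ => ?_
  rw [rename_symb]
  exact invertibleOn_symb _ _

end MonTri

/-! ### Extended sums, and recursion for row sums at the first coordinate. -/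

namespace MonTri

theorem extSum_of_le {a b : ℤ} (h : a ≤ b + 1) (f : ℤ → ℤ) :
    extSum a b f = ∑ i ∈ Finset.Icc a b, f i := by
  unfold extSum
  split_ifs with h1
  · rfl
  · rw [Finset.Icc_eq_empty (by omega), Finset.Icc_eq_empty h1]
    simp

theorem extSum_of_ge {a b : ℤ} (h : b + 1 ≤ a) (f : ℤ → ℤ) :
    extSum a b f = - ∑ i ∈ Finset.Icc (b + 1) (a - 1), f i := by
  rw [extSum, if_neg (by omega)]

theorem extSum_self_sub_one (a : ℤ) (f : ℤ → ℤ) : extSum a (a - 1) f = 0 := by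
  rw [extSum_of_le (by omega), Finset.Icc_eq_empty (by omega), Finset.sum_empty]

theorem extSum_add_one_self (a : ℤ) (f : ℤ → ℤ) : extSum (a + 1) a f = 0 := by
  simpa using extSum_self_sub_one (a + 1) f

theorem extSum_succ_left (a b : ℤ) (f : ℤ → ℤ) : extSum a b f = f a + extSum (a + 1) b f := by
  rcases le_or_gt a b with h | h
  · rw [extSum_of_le (by omega), extSum_of_le (by omega), ← Finset.insert_Icc_add_one_left_eq_Icc h,
      Finset.sum_insert (by simp)]
  · rw [extSum_of_ge (by omega), extSum_of_ge (by omega), add_sub_cancel_right,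
      ← Finset.insert_Icc_sub_one_right_eq_Icc (show b + 1 ≤ a by omega),
      Finset.sum_insert (by simp)]
    ring

theorem extSum_succ_right (a b : ℤ) (f : ℤ → ℤ) :
    extSum a b f = extSum a (b - 1) f + f b := by
  rcases le_or_gt a b with h | h
  · rw [extSum_of_le (by omega), extSum_of_le (by omega),
      ← Finset.insert_Icc_sub_one_right_eq_Icc h, Finset.sum_insert (by simp), add_comm]
  · rw [extSum_of_ge (by omega), extSum_of_ge (by omega), sub_add_cancel,
      ← Finset.insert_Icc_add_one_left_eq_Icc (show b ≤ a - 1 by omega),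
      Finset.sum_insert (by simp)]
    ring

theorem extSum_add (a b : ℤ) (f g : ℤ → ℤ) :
    extSum a b (fun x => f x + g x) = extSum a b f + extSum a b g := by
  unfold extSum
  split_ifs
  · rw [Finset.sum_add_distrib]
  · rw [Finset.sum_add_distrib, neg_add]

/-- `Fin.cons` for integer tuples. -/
abbrev consZ {n : ℕ} (x : ℤ) (l : Fin n → ℤ) : Fin (n + 1) → ℤ := Fin.cons x l

/-- `Fin.snoc` for integer tuples. -/
abbrev snocZ {n : ℕ} (l : Fin n → ℤ) (x : ℤ) : Fin (n + 1) → ℤ := Fin.snoc l x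

theorem consZ_snocZ {n : ℕ} (x y : ℤ) (l : Fin n → ℤ) :
    consZ x (snocZ l y) = snocZ (consZ x l) y := Fin.cons_snoc_eq_snoc_cons x l y

theorem rowSum_snoc (n : ℕ) (K : Fin (n + 1) → ℤ) (m z : ℤ) (A : (Fin (n + 2) → ℤ) → ℤ) :
    rowSum (n + 2) (snocZ (snocZ K m) z) A =
      rowSum (n + 1) (snocZ K m) (fun l => extSum (m + 1) z (fun x => A (snocZ l x))) +
      rowSum (n + 1) (snocZ K (m - 1)) (fun l => A (snocZ l m)) := by
  rw [rowSum]
  simp [snocZ, Fin.update_snoc_last]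

/-- The definition peels off the last coordinate; the induction below needs the first. For
increasing bottom rows the two summands are the cases `l_1 < b` and `l_1 = b`; in the latter `l_2 ≠
b` raises the next lower bound to `b + 1`. -/
theorem rowSum_cons (n : ℕ) (a b : ℤ) (K : Fin n → ℤ) (A : (Fin (n + 1) → ℤ) → ℤ) :
    rowSum (n + 1) (consZ a (consZ b K)) A =
      extSum a (b - 1) (fun x => rowSum n (consZ b K) (slice x A)) +
      rowSum n (consZ (b + 1) K) (slice b A) := by
  induction n using Nat.strongRec with
  | ind n ih =>
  match n, K, A, ih with
  | 0, K, A, _ =>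
    have h : ∀ x, slice x A ![] = A ![x] := fun x => rfl
    simp only [rowSum, h]
    exact extSum_succ_right _ _ _
  | 1, K, A, _ =>
    obtain ⟨z, rfl⟩ : ∃ z, K = snocZ ![] z := ⟨K 0, by ext i; fin_cases i; rfl⟩
    have h1 : consZ a (consZ b (snocZ ![] z)) = snocZ (snocZ ![a] b) z := by
      ext i; fin_cases i <;> rfl
    have h2 : ∀ x, (snocZ ![a] x) 0 = a := fun x => rfl
    have h3 : ∀ x, (snocZ ![a] x) 1 = x := fun x => rfl
    have h4 : ∀ x y, slice x A ![y] = A ![x, y] := fun x y => rfl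
    have h5 : ∀ x y, snocZ ![x] y = ![x, y] := fun x y => by ext i; fin_cases i <;> rfl
    have h6 : ∀ x, consZ x (snocZ ![] z) 0 = x := fun x => rfl
    have h7 : ∀ x, consZ x (snocZ ![] z) 1 = z := fun x => rfl
    rw [h1, rowSum_snoc]
    simp only [rowSum, h2, h3, h4, h5, h6, h7]
    simp_rw [extSum_succ_left b z, extSum_add]
    rw [extSum_succ_right a b]
    ring
  | n + 2, K, A, ih =>
    obtain ⟨K', m, z, rfl⟩ : ∃ (K' : Fin n → ℤ) (m z : ℤ), K = snocZ (snocZ K' m) z :=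
      ⟨Fin.init (Fin.init K), Fin.init K (Fin.last _), K (Fin.last _), by simp [snocZ]⟩
    simp only [consZ_snocZ]
    rw [rowSum_snoc, rowSum_snoc]
    simp_rw [rowSum_snoc]
    rw [extSum_add]
    simp only [← consZ_snocZ]
    rw [ih (n + 1) (by omega), ih (n + 1) (by omega)]
    have h1 : ∀ x : ℤ, slice x (fun l : Fin (n + 2) → ℤ => extSum (m + 1) z fun y =>
        A (snocZ l y)) = fun l => extSum (m + 1) z fun y => slice x A (snocZ l y) := fun x => by
      funext l
      simp only [slice_apply, consZ_snocZ]
    have h2 : ∀ x : ℤ, slice x (fun l : Fin (n + 2) → ℤ => A (snocZ l m)) =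
        fun l => slice x A (snocZ l m) := fun x => by
      funext l
      simp only [slice_apply, consZ_snocZ]
    simp only [h1, h2]
    ring

/-- The forward difference in the first coordinate of a row sum. -/
theorem rowSum_sub_cons (n : ℕ) (a : ℤ) (K : Fin (n + 1) → ℤ) (A : (Fin (n + 1) → ℤ) → ℤ) :
    rowSum (n + 1) (consZ (a + 1) K) A = rowSum (n + 1) (consZ a K) A -
      rowSum n K (slice a A) := by
  obtain ⟨b, K, rfl⟩ : ∃ b K', K = consZ b K' := ⟨K 0, Fin.tail K, (Fin.cons_self_tail K).symm⟩
  rw [rowSum_cons, rowSum_cons, extSum_succ_left a]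
  ring

/-- This is the vanishing of `(id + E_2 Δ_1)` applied to the row sum at points with equal first two
coordinates. It supplies the constant that the difference equation in the first coordinate leaves
open. -/
theorem rowSum_diagonal (n : ℕ) (a : ℤ) (K : Fin n → ℤ) (A : (Fin (n + 1) → ℤ) → ℤ) :
    rowSum (n + 1) (consZ a (consZ a K)) A + rowSum (n + 1) (consZ (a + 1) (consZ (a + 1) K)) A -
      rowSum (n + 1) (consZ a (consZ (a + 1) K)) A = 0 := by
  simp only [rowSum_cons, extSum_self_sub_one, add_sub_cancel_right]
  rw [extSum_succ_right a a, extSum_self_sub_one, extSum_add_one_self]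
  ring

end MonTri

/-! ### Antisymmetry, and the operator identity for row sums. -/

namespace MonTri

open MvPolynomial

variable {M : Type*} [AddCommGroup M]

/-- The alternating sum of the functions obtained by forgetting one coordinate. -/
def altSum {m : ℕ} (f : (Fin m → ℤ) → M) : (Fin (m + 1) → ℤ) → M :=
  ∑ j : Fin (m + 1), (-1 : ℤ) ^ (j : ℕ) • pullback j.succAbove f

/-- Functions that change sign when two coordinates are exchanged. -/
def Antisymm {m : ℕ} (f : (Fin m → ℤ) → M) : Prop :=
  ∀ i j, i ≠ j → pullback (Equiv.swap i j) f = -f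

theorem altSum_apply {m : ℕ} (f : (Fin m → ℤ) → M) (k : Fin (m + 1) → ℤ) :
    altSum f k = ∑ j : Fin (m + 1), (-1 : ℤ) ^ (j : ℕ) • f (k ∘ j.succAbove) := by
  simp [altSum, Finset.sum_apply]

/-- The pulled back function does not depend on coordinate `i.succ`, so `E_{i.succ}` acts trivially
on it and the factor `id + E_{i.succ} Δ_0` collapses to `E_0`. This is the source of the shifts `∏ X
i` in `rowSum_eq_of_act`. -/
theorem act_symbZero_pullback {m : ℕ} (i : Fin (m + 1)) (f : (Fin (m + 1) → ℤ) → M) :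
    act (symbZero (m + 1)) (pullback i.succ.succAbove f) =
      act (X 0) (pullback i.succ.succAbove (act (symbZero m) f)) := by
  have h1 : symbZero (m + 1) = rename i.succ.succAbove (symbZero m) * symb 0 i.succ := by
    rw [symbZero, Fin.prod_univ_succAbove _ i, mul_comm, symbZero, map_prod]
    congr 1
    refine Finset.prod_congr rfl fun j _ => ?_
    rw [rename_symb, Fin.succ_succAbove_zero, Fin.succ_succAbove_succ]
  have h2 : act (symb 0 i.succ) (pullback i.succ.succAbove f) =
      act (X 0) (pullback i.succ.succAbove f) := by
    rw [symb, mul_comm, act_add_apply, act_mul_apply,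
      act_X_pullback (fun j => Fin.succAbove_ne _ _), act_sub_apply, act_one_apply]
    abel
  rw [h1, act_mul_apply, h2, act_comm, pullback_act Fin.succAbove_right_injective]

/-- The terms omitting coordinate `0` and coordinate `1` are exchanged and carry opposite signs;
every other term still contains both coordinates and changes sign by the antisymmetry of `f`. -/
theorem pullback_swap_altSum {m : ℕ} {f : (Fin (m + 1) → ℤ) → M} (hf : Antisymm f) :
    pullback (Equiv.swap 0 1) (altSum f) = -altSum f := by
  funext k
  simp only [pullback_apply, altSum_apply, Pi.neg_apply,
    Fin.sum_univ_succ (n := m + 1), Fin.sum_univ_succ (n := m)]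
  have h0 : ∀ k : Fin (m + 2) → ℤ, (k ∘ Equiv.swap 0 1) ∘ Fin.succAbove (0 : Fin (m + 2)) =
      k ∘ Fin.succAbove (Fin.succ 0) := by
    intro k
    funext j
    cases j using Fin.cases with
    | zero => simp
    | succ j =>
      have h : Equiv.swap (0 : Fin (m + 2)) 1 j.succ.succ = j.succ.succ :=
        Equiv.swap_apply_of_ne_of_ne (Fin.succ_ne_zero _) (by simp [Fin.ext_iff])
      simp only [Function.comp_apply, Fin.succ_succAbove_succ, Fin.zero_succAbove, h]
  have h1 : (k ∘ Equiv.swap 0 1) ∘ Fin.succAbove (Fin.succ (0 : Fin (m + 1))) =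
      k ∘ Fin.succAbove 0 := by
    rw [← h0, Function.comp_assoc k, ← Equiv.coe_trans, Equiv.swap_swap, Equiv.coe_refl,
      Function.comp_id]
  have h2 : ∀ i : Fin m, f ((k ∘ Equiv.swap 0 1) ∘ Fin.succAbove i.succ.succ) =
      -f (k ∘ Fin.succAbove i.succ.succ) := by
    intro i
    obtain ⟨m, rfl⟩ : ∃ m', m = m' + 1 := ⟨m - 1, by have := i.2; omega⟩
    have := congrFun (hf 0 1 (by simp)) (k ∘ Fin.succAbove i.succ.succ)
    rw [Pi.neg_apply, pullback_apply] at this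
    rw [← this]
    congr 1
    funext j
    cases j using Fin.cases with
    | zero => simp
    | succ j =>
      cases j using Fin.cases with
      | zero => simp
      | succ j =>
        have h : Equiv.swap (0 : Fin (m + 3)) 1 (Fin.succAbove i.succ.succ j.succ.succ) =
            Fin.succAbove i.succ.succ j.succ.succ := by
          simp only [Fin.succ_succAbove_succ]
          exact Equiv.swap_apply_of_ne_of_ne (Fin.succ_ne_zero _)
            (by rw [← Fin.succ_zero_eq_one, Ne, Fin.succ_inj]; exact Fin.succ_ne_zero _)
        have h' : Equiv.swap (0 : Fin (m + 2)) 1 j.succ.succ = j.succ.succ :=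
          Equiv.swap_apply_of_ne_of_ne (Fin.succ_ne_zero _) (by simp [Fin.ext_iff])
        simp only [Function.comp_apply, h, h']
  simp only [h0, h1, h2]
  simp only [Fin.val_zero, Fin.val_succ, pow_succ, smul_neg, Finset.sum_neg_distrib]
  simp
  abel

/-- The symbol of the product of the operators `id + E_q Δ_p` with `(p, q) ≠ (0, 1)`. -/
noncomputable def symbRest (n : ℕ) : MvPolynomial (Fin (n + 2)) ℤ :=
  ∏ x ∈ (pairs (n + 2)).erase (0, 1), symb x.1 x.2

theorem symbProd_eq_mul_symbRest (n : ℕ) : symbProd (n + 2) = symbRest n * symb 0 1 := by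
  rw [symbProd, symbRest, Finset.prod_erase_mul]
  simp [pairs]

theorem invertibleOn_symbRest (n : ℕ) : InvertibleOn M (symbRest n) :=
  InvertibleOn.prod _ fun _ _ => invertibleOn_symb _ _

/-- The swap exchanges the pairs `(0, q)` and `(1, q)` for `q ≥ 2` and fixes the others. Only `(0,
1)` would lose its order. -/
theorem rename_swap_symbRest (n : ℕ) : rename (Equiv.swap 0 1) (symbRest n) = symbRest n := by
  have key : ∀ x ∈ (pairs (n + 2)).erase (0, 1),
      (Equiv.swap 0 1 x.1, Equiv.swap 0 1 x.2) ∈ (pairs (n + 2)).erase (0, 1) := by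
    rintro ⟨p, q⟩ h
    simp only [pairs, Finset.mem_erase, Finset.mem_filter, Finset.mem_univ, true_and, ne_eq,
      Prod.mk.injEq, Fin.lt_def, Fin.ext_iff, Fin.val_zero, Fin.val_one] at h ⊢
    have hv : ∀ r : Fin (n + 2), ((Equiv.swap 0 1 r : Fin (n + 2)) : ℕ) =
        if (r : ℕ) = 0 then (1 : ℕ) else if (r : ℕ) = 1 then (0 : ℕ) else (r : ℕ) := by
      intro r
      rw [Equiv.swap_apply_def]
      simp only [Fin.ext_iff, Fin.val_zero, Fin.val_one]
      split_ifs <;> simp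
    rw [hv, hv]
    split_ifs <;> omega
  rw [symbRest, map_prod]
  refine Finset.prod_nbij' (fun x => (Equiv.swap 0 1 x.1, Equiv.swap 0 1 x.2))
    (fun x => (Equiv.swap 0 1 x.1, Equiv.swap 0 1 x.2)) key key ?_ ?_ ?_
  · intro x _; simp
  · intro x _; simp
  · intro x _; rw [rename_symb]

theorem rename_swap_succ_symbZero {m : ℕ} (i j : Fin m) :
    rename (Equiv.swap i.succ j.succ) (symbZero m) = symbZero m := by
  rw [symbZero, map_prod, ← Equiv.prod_comp (Equiv.swap i j) (fun q => symb 0 q.succ)]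
  refine Finset.prod_congr rfl fun q _ => ?_
  rw [rename_symb, Equiv.swap_apply_of_ne_of_ne (Fin.succ_ne_zero i).symm (Fin.succ_ne_zero j).symm,
    (Fin.succ_injective m).map_swap]

theorem rename_equiv_prod_X {m : ℕ} (e : Equiv.Perm (Fin m)) :
    rename e (∏ i, X i : MvPolynomial (Fin m) ℤ) = ∏ i, X i := by
  simp only [map_prod, rename_X]
  exact Equiv.prod_comp e _

/-- `symbZero m` is symmetric in all coordinates but the first, so inverting it preserves the
antisymmetry of `Δ_0 f` in those coordinates. -/
theorem Antisymm.slice_of_symbZero {m : ℕ} {f g : (Fin (m + 1) → ℤ) → M} (hf : Antisymm f)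
    (hg : LocNil g) (h : act (symbZero m) g = act (X 0 - 1) f) (x : ℤ) :
    Antisymm (slice x g) := by
  intro i j hij
  have hs : pullback (Equiv.swap i.succ j.succ) g = -g := by
    refine (invertibleOn_symbZero m).injective (hg.pullback (Equiv.injective _))
      (by simpa using hg.smul (-1)) ?_
    rw [← rename_swap_succ_symbZero i j, ← pullback_act (Equiv.injective _), h,
      rename_swap_succ_symbZero, act_neg, h, pullback_act (Equiv.injective _),
      hf _ _ (by simpa using hij), act_neg, map_sub, rename_X, map_one,
      Equiv.swap_apply_of_ne_of_ne (Fin.succ_ne_zero i).symm (Fin.succ_ne_zero j).symm]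
  funext l
  have := congrFun hs (Fin.cons x l)
  rw [pullback_apply, Pi.neg_apply] at this
  rw [pullback_apply, slice_apply, Pi.neg_apply, slice_apply, ← this]
  congr 1
  funext q
  cases q using Fin.cases with
  | zero =>
    rw [Function.comp_apply,
      Equiv.swap_apply_of_ne_of_ne (Fin.succ_ne_zero i).symm (Fin.succ_ne_zero j).symm]
    simp
  | succ q => rw [Function.comp_apply, ← (Fin.succ_injective m).map_swap]; simp

/-- The term omitting coordinate `0` is constant in it and disappears; reindexing the others costs
one sign. -/
theorem act_X_zero_sub_one_altSum {m : ℕ} (f : (Fin (m + 1) → ℤ) → M) :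
    act (X 0 - 1) (altSum f) =
      -∑ i : Fin (m + 1), (-1 : ℤ) ^ (i : ℕ) • pullback i.succ.succAbove (act (X 0 - 1) f) := by
  rw [altSum, act_sum, Fin.sum_univ_succ]
  have h0 : act (X 0 - 1) (pullback (Fin.succAbove 0) f) = 0 := by
    rw [act_sub_apply, act_X_pullback (fun j => Fin.succAbove_ne _ _), act_one_apply, sub_self]
  rw [act_smul, h0, smul_zero, zero_add, ← Finset.sum_neg_distrib]
  refine Finset.sum_congr rfl fun i _ => ?_
  rw [pullback_act Fin.succAbove_right_injective, map_sub, rename_X, map_one,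
    Fin.succ_succAbove_zero, act_smul, Fin.val_succ, pow_succ, mul_neg_one, neg_smul]

/-- The row sum operator, on functions whose image under `∏_{p < q} (id + E_q Δ_p)` is
antisymmetric. -/
theorem rowSum_eq_of_act {m : ℕ} {C A : (Fin m → ℤ) → ℤ} {F : (Fin (m + 1) → ℤ) → ℤ}
    (hC : LocNil C) (hA : LocNil A) (hF : LocNil F) (hanti : Antisymm C)
    (h1 : act (symbProd m) A = act (∏ i, (X i - 1)) C)
    (h2 : act (symbProd (m + 1)) F = act (∏ i, X i) (altSum C)) (k : Fin (m + 1) → ℤ) :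
    rowSum m k A = F k := by
  induction m with
  | zero =>
    have hp0 : symbProd 0 = 1 := by simp [symbProd_eq]
    have hp1 : symbProd 1 = 1 := by simp [symbProd_eq]
    rw [hp0, Finset.univ_eq_empty, Finset.prod_empty, act_one_apply, act_one_apply] at h1
    rw [hp1, act_one_apply, Fin.prod_univ_succ, Finset.univ_eq_empty, Finset.prod_empty,
      mul_one] at h2
    rw [h2, h1, rowSum, act_X, altSum_apply, Fin.sum_univ_succ]
    simp only [Fin.val_zero, pow_zero, one_smul, Finset.univ_eq_empty, Finset.sum_empty, add_zero]
    congr 1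
    exact Subsingleton.elim _ _
  | succ m ih =>
    -- The slices of `C'` take the role of `C` for the slices of `A`, and the slices of `Y` take the
    -- role of `F`.
    obtain ⟨C', hC', hCC⟩ := (invertibleOn_symbZero m).surjective (hC.act (X 0 - 1))
    obtain ⟨Y, hY, hYY⟩ :=
      (invertibleOn_rename_symbProd (n := m + 1) Fin.succ).surjective (M := ℤ)
      (LocNil.act (LocNil.sum Finset.univ fun (i : Fin (m + 1)) _ =>
        (hC'.pullback (Fin.succAbove_right_injective (p := i.succ))).smul ((-1) ^ (i : ℕ)))
        (∏ i : Fin (m + 1), X i.succ))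
    have hB : act (rename Fin.succ (symbProd m)) A = act (∏ i : Fin m, (X i.succ - 1)) C' := by
      refine (invertibleOn_symbZero m).injective (hA.act _) (hC'.act _) ?_
      rw [← act_mul_apply, ← symbProd_succ, h1, act_comm, hCC, Fin.prod_univ_succ, mul_comm,
        act_mul_apply]
    have hslice : ∀ x l, rowSum m l (slice x A) = Y (consZ x l) := by
      intro x l
      refine ih (hC'.slice x) (hA.slice x) (hY.slice x) (hanti.slice_of_symbZero hC' hCC x) ?_ ?_ l
      · rw [slice_act, hB, slice_act, map_prod]
        simp
      · rw [slice_act, hYY]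
        have : altSum (slice x C') = slice (M := ℤ) x (∑ i : Fin (m + 1),
            (-1 : ℤ) ^ (i : ℕ) • pullback i.succ.succAbove C') := by
          funext l
          simp only [altSum_apply, slice_apply, Finset.sum_apply, Pi.smul_apply, pullback_apply]
          refine Finset.sum_congr rfl fun i _ => ?_
          congr 2
          funext q
          cases q using Fin.cases <;> simp
        rw [this, slice_act, map_prod]
        simp
    -- Compared after applying `symbProd (m + 2)`: on the side of `Y`, `act_symbZero_pullback`
    -- contributes the factor `X 0` that completes the product of the remaining shifts.
    have hdiff : Y = -act (X 0 - 1) F := by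
      refine (invertibleOn_symbProd (m + 2)).injective hY
        (by simpa using (hF.act (X 0 - 1)).smul (-1)) ?_
      rw [act_neg, act_comm, h2, act_comm, act_X_zero_sub_one_altSum, act_neg, neg_neg,
        symbProd_succ, act_mul_apply, hYY, act_comm, act_sum,
        Fin.prod_univ_succ (n := m + 1), mul_comm (X 0), act_mul_apply, act_sum, act_sum,
        act_sum]
      refine Finset.sum_congr rfl fun i _ => ?_
      rw [act_smul, act_smul, act_smul, act_smul, act_symbZero_pullback, hCC]
    -- `symbRest` and `∏ X i` are symmetric under the swap of `0` and `1`, so `(id + E_1 Δ_0) F`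
    -- inherits the antisymmetry of `altSum C` under it. On the diagonal it equals its own negative.
    have hsymm : ∀ a K, act (symb 0 1) F (consZ a (consZ a K)) = 0 := by
      intro a K
      have hs : pullback (Equiv.swap 0 1) (act (symb 0 1) F) = -act (symb 0 1) F := by
        refine (invertibleOn_symbRest m).injective ((hF.act _).pullback (Equiv.injective _))
          (by simpa using (hF.act (symb 0 1)).smul (-1)) ?_
        conv_lhs => rw [← rename_swap_symbRest]
        rw [← pullback_act (Equiv.injective _), act_neg, ← act_mul_apply,
          ← symbProd_eq_mul_symbRest, h2, pullback_act (Equiv.injective _), rename_equiv_prod_X,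
          pullback_swap_altSum hanti, act_neg]
      have := congrFun hs (consZ a (consZ a K))
      rw [pullback_apply, Pi.neg_apply] at this
      have hk : consZ a (consZ a K) ∘ Equiv.swap 0 1 = consZ a (consZ a K) := by
        funext q
        rw [Function.comp_apply, Equiv.swap_apply_def]
        split_ifs with hq hq
        · subst hq; rfl
        · subst hq; rfl
        · rfl
      rw [hk] at this
      omega
    have hF0 : ∀ a K, F (consZ (a + 1) K) = F (consZ a K) - rowSum m K (slice a A) := by
      intro a K
      rw [hslice, hdiff, Pi.neg_apply, act_sub_apply, Pi.sub_apply, act_X, act_one_apply]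
      simp
    have hF1 : ∀ a K, F (consZ a (consZ a K)) + F (consZ (a + 1) (consZ (a + 1) K)) -
        F (consZ a (consZ (a + 1) K)) = 0 := by
      intro a K
      have := hsymm a K
      have e1 : Function.update (consZ a (consZ a K)) 1 (a + 1) = consZ a (consZ (a + 1) K) := by
        rw [show (1 : Fin (m + 2)) = Fin.succ 0 from rfl, consZ, consZ, ← Fin.cons_update,
          Fin.update_cons_zero]
      rw [symb, act_add_apply, Pi.add_apply, act_one_apply, act_mul_apply, act_X,
        show consZ a (consZ a K) 1 = a from rfl, e1, act_sub_apply, Pi.sub_apply, act_X,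
        act_one_apply, Fin.update_cons_zero] at this
      simp only [Fin.cons_zero] at this
      linarith
    have hconst : ∀ a b K, rowSum (m + 1) (consZ a K) A - F (consZ a K) =
        rowSum (m + 1) (consZ b K) A - F (consZ b K) := by
      have step : ∀ a K, rowSum (m + 1) (consZ (a + 1) K) A - F (consZ (a + 1) K) =
          rowSum (m + 1) (consZ a K) A - F (consZ a K) := by
        intro a K
        rw [rowSum_sub_cons, hF0]
        ring
      have h0 : ∀ a K, rowSum (m + 1) (consZ a K) A - F (consZ a K) =
          rowSum (m + 1) (consZ 0 K) A - F (consZ 0 K) := by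
        intro a K
        induction a using Int.induction_on with
        | zero => rfl
        | succ a ha => rw [step, ha]
        | pred a ha => rw [← ha, ← step (-a - 1), sub_add_cancel]
      intro a b K
      rw [h0 a, h0 b]
    obtain ⟨a, b, K, rfl⟩ : ∃ a b K', k = consZ a (consZ b K') :=
      ⟨k 0, k 1, Fin.tail (Fin.tail k), by
        funext q
        cases q using Fin.cases with
        | zero => rfl
        | succ q => cases q using Fin.cases <;> rfl⟩
    -- Let `D` be the row sum minus `F`, which is independent of the first coordinate. In `D(b, b) +
    -- D(b+1, b+1) - D(b, b+1) = 0` the last two terms cancel, so `D(b, b) = 0` and therefore `D(a,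
    -- b) = 0`.
    have e1 := hconst a b (consZ b K)
    have e2 := hconst (b + 1) b (consZ (b + 1) K)
    have e3 := hF1 b K
    have e4 := rowSum_diagonal m b K A
    linarith

end MonTri

/-! ### Determinants of binomial coefficients, and the operator formula for `α`. -/

namespace MonTri

open MvPolynomial

/-- The product of functions of one coordinate each. -/
def prodFn {R : Type*} [CommRing R] {n : ℕ} (g : Fin n → ℤ → R) : (Fin n → ℤ) → R :=
  fun k => ∏ i, g i (k i)

theorem act_X_sub_one_prodFn {R : Type*} [CommRing R] {n : ℕ} (g : Fin n → ℤ → R) (i : Fin n) :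
    act (X i - 1) (prodFn g) = prodFn (Function.update g i (fwdDiff 1 (g i))) := by
  funext k
  rw [act_sub_apply, act_one_apply, Pi.sub_apply, act_X]
  simp only [prodFn]
  rw [← Finset.mul_prod_erase _ _ (Finset.mem_univ i), ← Finset.mul_prod_erase _ _
    (Finset.mem_univ i), ← Finset.mul_prod_erase _ _ (Finset.mem_univ i), Function.update_self,
    Function.update_self, fwdDiff, sub_mul]
  congr 2
  · refine Finset.prod_congr rfl fun j hj => ?_
    rw [Function.update_of_ne (Finset.ne_of_mem_erase hj),
      Function.update_of_ne (Finset.ne_of_mem_erase hj)]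
  · refine Finset.prod_congr rfl fun j hj => ?_
    rw [Function.update_of_ne (Finset.ne_of_mem_erase hj)]

theorem act_pow_prodFn {R : Type*} [CommRing R] {n : ℕ} (g : Fin n → ℤ → R) (i : Fin n) (N : ℕ) :
    act ((X i - 1) ^ N) (prodFn g) = prodFn (Function.update g i ((fwdDiff 1)^[N] (g i))) := by
  induction N with
  | zero => simp [act_one_apply]
  | succ N ih =>
    rw [pow_succ', act_mul_apply, ih, act_X_sub_one_prodFn, Function.update_self,
      Function.update_idem, Function.iterate_succ_apply']

theorem act_prod_prodFn {R : Type*} [CommRing R] {n : ℕ} (g : Fin n → ℤ → R) (s : Finset (Fin n)) :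
    act (∏ i ∈ s, (X i - 1)) (prodFn g) =
      prodFn (fun i => if i ∈ s then fwdDiff 1 (g i) else g i) := by
  induction s using Finset.induction_on with
  | empty => simp [act_one_apply]
  | insert a s ha ih =>
    rw [Finset.prod_insert ha, act_mul_apply, ih, act_X_sub_one_prodFn]
    congr 1
    funext i
    by_cases h : i = a
    · subst h; simp [ha]
    · simp [h]

theorem locNil_prodFn {R : Type*} [CommRing R] {n : ℕ} {g : Fin n → ℤ → R}
    (hg : ∀ i, ∃ N, (fwdDiff 1)^[N] (g i) = 0) : LocNil (prodFn g) := fun i => by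
  obtain ⟨N, hN⟩ := hg i
  refine ⟨N, ?_⟩
  rw [act_pow_prodFn, hN]
  funext k
  exact Finset.prod_eq_zero (Finset.mem_univ i) (by simp)

theorem act_prod_X {M : Type*} [AddCommGroup M] {n : ℕ} (f : (Fin n → ℤ) → M)
    (k : Fin n → ℤ) : act (∏ i, X i) f k = f (fun i => k i + 1) := by
  have h : ∀ s : Finset (Fin n), ∀ k, act (∏ i ∈ s, X i) f k =
      f (fun i => if i ∈ s then k i + 1 else k i) := by
    intro s
    induction s using Finset.induction_on with
    | empty => simp [act_one_apply]
    | insert a s ha ih =>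
      intro k
      rw [Finset.prod_insert ha, act_mul_apply, act_X, ih]
      congr 1
      funext i
      by_cases h : i = a
      · subst h; simp [ha]
      · simp [h]
  simpa using h Finset.univ k

theorem fwdDiff_ringChoose_succ (j : ℕ) :
    fwdDiff 1 (fun x : ℤ => Ring.choose x (j + 1)) = fun x => Ring.choose x j := by
  funext x
  rw [fwdDiff, Ring.choose_succ_succ, add_sub_cancel_right]

theorem fwdDiff_iterate_ringChoose (j : ℕ) :
    (fwdDiff 1)^[j + 1] (fun x : ℤ => Ring.choose x j) = 0 := by
  induction j with
  | zero =>
    funext x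
    simp [fwdDiff]
  | succ j ih => rw [Function.iterate_succ_apply, fwdDiff_ringChoose_succ, ih]

/-- The determinant of the binomial coefficients `k_i` choose `j + c`. -/
noncomputable def chooseDet (c n : ℕ) (k : Fin n → ℤ) : ℤ :=
  (Matrix.of fun i j : Fin n => Ring.choose (k i) ((j : ℕ) + c)).det

theorem chooseDet_eq_sum (c n : ℕ) : chooseDet c n = ∑ σ : Equiv.Perm (Fin n),
    (Equiv.Perm.sign σ : ℤ) • prodFn fun i x => Ring.choose x ((σ i : ℕ) + c) := by
  funext k
  rw [chooseDet, ← Matrix.det_transpose, Matrix.det_apply', Finset.sum_apply]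
  rfl

theorem locNil_chooseDet (c n : ℕ) : LocNil (chooseDet c n) := by
  rw [chooseDet_eq_sum]
  exact LocNil.sum _ fun σ _ => (locNil_prodFn fun i =>
    ⟨_, fwdDiff_iterate_ringChoose _⟩).smul _

/-- In each term of the Leibniz expansion, every coordinate occurs in exactly one binomial
coefficient, whose lower index is reduced by the difference. -/
theorem act_prod_chooseDet (c n : ℕ) :
    act (∏ i, (X i - 1)) (chooseDet (c + 1) n) = chooseDet c n := by
  rw [chooseDet_eq_sum, chooseDet_eq_sum, act_sum]
  refine Finset.sum_congr rfl fun σ _ => ?_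
  rw [act_smul, act_prod_prodFn]
  simp only [Finset.mem_univ, if_true, ← add_assoc, fwdDiff_ringChoose_succ]

theorem antisymm_chooseDet (c n : ℕ) : Antisymm (chooseDet c n) := by
  intro i j hij
  funext k
  rw [pullback_apply, Pi.neg_apply, chooseDet, chooseDet]
  have := Matrix.det_permute (Equiv.swap i j)
    (Matrix.of fun i j : Fin n => Ring.choose (k i) ((j : ℕ) + c))
  rw [Equiv.Perm.sign_swap hij] at this
  simp only [Units.val_neg, Units.val_one, Int.cast_neg, Int.cast_one, neg_one_mul] at this
  exact this

/-- Laplace expansion along the first column of `chooseDet 0 (n + 1)`, whose entries `k_i choose 0`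
are all `1`. -/
theorem altSum_chooseDet (n : ℕ) : altSum (chooseDet 1 n) = chooseDet 0 (n + 1) := by
  funext k
  rw [altSum_apply, chooseDet, Matrix.det_succ_column_zero]
  refine Finset.sum_congr rfl fun i _ => ?_
  simp only [Matrix.of_apply, Fin.val_zero, add_zero, Ring.choose_zero_right, mul_one, smul_eq_mul]
  rfl

/-- By Pascal's rule, the shift adds to each column the preceding column of the unshifted matrix. -/
theorem chooseDet_add_one (n : ℕ) (k : Fin n → ℤ) :
    chooseDet 0 n (fun i => k i + 1) = chooseDet 0 n k := by
  cases n with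
  | zero => simp [chooseDet]
  | succ n =>
    refine (Matrix.det_eq_of_forall_col_eq_smul_add_pred (fun _ => -1) ?_ ?_).symm
    · intro i; simp
    · intro i j
      simp only [Matrix.of_apply, Fin.val_succ, add_zero, Fin.val_castSucc, Ring.choose_succ_succ]
      ring

theorem act_prod_X_chooseDet (n : ℕ) : act (∏ i, X i) (chooseDet 0 n) = chooseDet 0 n := by
  funext k
  rw [act_prod_X, chooseDet_add_one]

/-- The operator formula for `α`, as an identity of functions on `ℤⁿ`. -/
theorem alpha_spec (n : ℕ) : LocNil (alpha (n + 1)) ∧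
    act (symbProd (n + 1)) (alpha (n + 1)) = chooseDet 0 (n + 1) := by
  induction n with
  | zero =>
    have h1 : alpha 1 = chooseDet 0 1 := by
      funext k
      simp [alpha, chooseDet]
    have hp1 : symbProd 1 = 1 := by simp [symbProd_eq]
    rw [h1, hp1, act_one_apply]
    exact ⟨locNil_chooseDet _ _, rfl⟩
  | succ n ih =>
    obtain ⟨F, hF, hFe⟩ :=
      (invertibleOn_symbProd (M := ℤ) (n + 2)).surjective (locNil_chooseDet 0 (n + 2))
    have h : alpha (n + 2) = F := by
      funext k
      refine rowSum_eq_of_act (locNil_chooseDet 1 (n + 1)) ih.1 hF (antisymm_chooseDet _ _) ?_ ?_ k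
      · rw [ih.2, act_prod_chooseDet]
      · rw [hFe, altSum_chooseDet, act_prod_X_chooseDet]
    exact h ▸ ⟨hF, hFe⟩

end MonTri

/-! ### Transfer between polynomials and functions on `ℤⁿ`. -/

namespace MonTri

open MvPolynomial

theorem act_map {M M' : Type*} [AddCommGroup M] [AddCommGroup M'] {n : ℕ} (φ : M →+ M')
    (p : MvPolynomial (Fin n) ℤ) (f : (Fin n → ℤ) → M) :
    act p (fun k => φ (f k)) = fun k => φ (act p f k) := by
  have := act_intertwine (AlgHom.id ℤ (MvPolynomial (Fin n) ℤ))
    (φ.toIntLinearMap.compLeft (Fin n → ℤ)) (fun i f => by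
      funext k
      simp only [AlgHom.coe_id, id_eq, act_X, LinearMap.compLeft_apply, Function.comp_apply]) p f
  exact this.symm

theorem LocNil.map {M M' : Type*} [AddCommGroup M] [AddCommGroup M'] {n : ℕ} (φ : M →+ M')
    {f : (Fin n → ℤ) → M} (hf : LocNil f) : LocNil (fun k => φ (f k)) := fun i => by
  obtain ⟨N, hN⟩ := hf i
  refine ⟨N, ?_⟩
  rw [act_map, hN]
  funext k
  exact map_zero φ

/-- Carries the correspondence between operators and their symbols from single factors to the whole
composition, which is a noncommutative product on one side only. -/
theorem noncommProd_rel {R S ι : Type*} [Monoid R] [CommMonoid S] (r : R → S → Prop)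
    (one : r 1 1) (mul : ∀ a b c d, r a c → r b d → r (a * b) (c * d)) (s : Finset ι)
    (f : ι → R) (g : ι → S) (comm) (h : ∀ x ∈ s, r (f x) (g x)) :
    r (s.noncommProd f comm) (∏ x ∈ s, g x) := by
  classical
  induction s using Finset.induction_on with
  | empty => simpa using one
  | insert a s ha ih =>
    rw [Finset.noncommProd_insert_of_notMem _ _ _ _ ha, Finset.prod_insert ha]
    exact mul _ _ _ _ (h a (Finset.mem_insert_self a s))
      (ih _ fun x hx => h x (Finset.mem_insert_of_mem hx))

theorem commute_ringInverse_left {R : Type*} [Ring R] {a b : R} (ha : IsUnit a)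
    (h : Commute a b) : Commute (Ring.inverse a) b := by
  obtain ⟨u, rfl⟩ := ha
  rw [Ring.inverse_unit]
  exact h.units_inv_left

theorem noncommProd_mul_noncommProd_inverse {R ι : Type*} [Ring R] (s : Finset ι) (f : ι → R)
    (hf : ∀ x, IsUnit (f x)) (hc : ∀ x y, Commute (f x) (f y)) (comm comm') :
    s.noncommProd f comm * s.noncommProd (fun x => Ring.inverse (f x)) comm' = 1 := by
  have hif : (s : Set ι).Pairwise fun x y => Commute (Ring.inverse (f x)) (f y) :=
    fun x _ y _ _ => commute_ringInverse_left (hf x) (hc x y)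
  rw [← Finset.noncommProd_mul_distrib f (fun x => Ring.inverse (f x)) comm comm' hif,
    Finset.noncommProd_eq_pow_card _ (f * fun x => Ring.inverse (f x)) _ 1
      (fun x _ => Ring.mul_inverse_cancel _ (hf x)), one_pow]

theorem one_add_mul_geom_sum_mul {R : Type*} [Ring R] {a b : R} (h : Commute a b) (N : ℕ) :
    (1 + a * b) * ∑ j ∈ Finset.range N, (-(a * b)) ^ j = 1 - (-a) ^ N * b ^ N := by
  have h1 := mul_neg_geom_sum (-(a * b)) N
  rwa [sub_neg_eq_add, ← neg_mul, h.neg_left.mul_pow, neg_mul] at h1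

/-- The function on `ℤⁿ` given by a polynomial. -/
noncomputable def toFn {n : ℕ} : MvPolynomial (Fin n) ℂ →ₗ[ℂ] ((Fin n → ℤ) → ℂ) where
  toFun P k := evalInt k P
  map_add' _ _ := funext fun _ => map_add _ _ _
  map_smul' _ _ := funext fun _ => smul_eval _ _ _

theorem toFn_apply {n : ℕ} (P : MvPolynomial (Fin n) ℂ) (k : Fin n → ℤ) :
    toFn P k = evalInt k P := rfl

theorem toFn_shift {n : ℕ} (i : Fin n) (P : MvPolynomial (Fin n) ℂ) :
    toFn (shift i P) = act (X i) (toFn P) := by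
  funext k
  rw [act_X, toFn_apply, toFn_apply]
  simp only [evalInt, shift, AlgHom.toLinearMap_apply]
  rw [← coe_aeval_eq_eval, ← coe_aeval_eq_eval]
  change aeval _ (aeval _ P) = aeval _ P
  rw [← AlgHom.comp_apply]
  congr 1
  refine algHom_ext fun j => ?_
  rw [AlgHom.comp_apply, aeval_X, aeval_X]
  by_cases h : j = i
  · subst h; simp
  · simp [h]

theorem toFn_diff {n : ℕ} (i : Fin n) (P : MvPolynomial (Fin n) ℂ) :
    toFn (diff i P) = act (X i - 1) (toFn P) := by
  rw [diff, LinearMap.sub_apply, map_sub, toFn_shift, act_sub_apply, act_one_apply]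
  rfl

theorem toFn_diff_pow {n : ℕ} (i : Fin n) (N : ℕ) (P : MvPolynomial (Fin n) ℂ) :
    toFn ((diff i ^ N) P) = act ((X i - 1) ^ N) (toFn P) := by
  induction N with
  | zero => rw [pow_zero, pow_zero, act_one_apply]; rfl
  | succ N ih => rw [pow_succ', pow_succ', act_mul_apply, ← ih, ← toFn_diff]; rfl

theorem toFn_factor {n : ℕ} (x : Fin n × Fin n) (P : MvPolynomial (Fin n) ℂ) :
    toFn (factor x P) = act (symb x.1 x.2) (toFn P) := by
  rw [factor, LinearMap.add_apply, map_add, symb, act_add_apply, act_mul_apply, act_one_apply,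
    ← toFn_diff, ← toFn_shift]
  rfl

theorem toFn_prodOp {n : ℕ} (P : MvPolynomial (Fin n) ℂ) :
    toFn (prodOp n P) = act (symbProd n) (toFn P) := by
  have h := noncommProd_rel
    (fun (a : Module.End ℂ (MvPolynomial (Fin n) ℂ)) (p : MvPolynomial (Fin n) ℤ) =>
      ∀ P : MvPolynomial (Fin n) ℂ, toFn (a P) = act p (toFn P))
    (fun P => by rw [act_one_apply, Module.End.one_apply])
    (fun a b c d hac hbd P => by rw [act_mul_apply, ← hbd, ← hac, Module.End.mul_apply])
    (pairs n) factor (fun x => symb x.1 x.2) (fun x _ y _ _ => factor_commute x y)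
    (fun x _ P => toFn_factor x P)
  exact h P

/-- The `i`-th coordinate ranges over the `D + 1` integers starting at `i * (D + 1)`, with `D` the
total degree. These blocks are consecutive, so every grid point is strictly increasing, and each is
too large for a nonzero polynomial to vanish on the whole grid. -/
theorem eq_zero_of_strictMono {n : ℕ} {P : MvPolynomial (Fin n) ℂ}
    (h : ∀ k : Fin n → ℤ, StrictMono k → evalInt k P = 0) : P = 0 := by
  set D := P.totalDegree with hD
  refine eq_zero_of_eval_zero_at_prod_finset P (fun i => (Finset.range (D + 1)).image
    fun t : ℕ => (((i : ℕ) * (D + 1) + t : ℕ) : ℂ)) ?_ ?_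
  · intro i
    rw [Finset.card_image_of_injective _ (fun a b hab => by
      have := Nat.cast_injective hab
      omega), Finset.card_range]
    exact Nat.lt_succ_of_le (degreeOf_le_totalDegree _ _)
  · intro x hx
    simp only [Finset.mem_image, Finset.mem_range] at hx
    choose t ht hxt using hx
    have hx : x = fun i : Fin n => (((((i : ℕ) * (D + 1) + t i : ℕ) : ℤ)) : ℂ) := by
      funext i
      rw [← hxt]
      push_cast
      rfl
    rw [hx]
    refine h _ fun i j hij => ?_
    have h1 := ht i
    have h2 : ((i : ℕ) + 1) * (D + 1) ≤ (j : ℕ) * (D + 1) := Nat.mul_le_mul_right _ hij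
    rw [add_mul, one_mul] at h2
    have h3 : (i : ℕ) * (D + 1) + t i < (j : ℕ) * (D + 1) + t j := by omega
    exact_mod_cast h3

theorem toFn_injective {n : ℕ} : Function.Injective (toFn (n := n)) := by
  rw [injective_iff_map_eq_zero]
  exact fun P hP => eq_zero_of_strictMono fun k _ => congrFun hP k

theorem locNil_toFn {n : ℕ} (P : MvPolynomial (Fin n) ℂ) : LocNil (toFn P) := by
  induction P using MvPolynomial.induction_on' with
  | monomial s a =>
    have h : toFn (monomial s a) = fun k => ((AddMonoidHom.mulLeft a).comp
        (Int.castAddHom ℂ)) (prodFn (fun i x => x ^ s i) k) := by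
      funext k
      rw [toFn_apply, evalInt, eval_monomial, Finsupp.prod_fintype _ _ (by simp)]
      simp [prodFn]
    rw [h]
    refine LocNil.map _ (locNil_prodFn fun i => ⟨s i + 1, ?_⟩)
    exact fwdDiff_iter_pow_eq_zero_of_lt (Nat.lt_succ_self _)
  | add P Q hP hQ => rw [map_add]; exact hP.add hQ

theorem exists_diff_pow_eq_zero {n : ℕ} (i : Fin n) (P : MvPolynomial (Fin n) ℂ) :
    ∃ N, (diff i ^ N) P = 0 := by
  obtain ⟨N, hN⟩ := locNil_toFn P i
  exact ⟨N, toFn_injective (by rw [toFn_diff_pow, hN, map_zero])⟩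

/-- Injectivity comes from the functions on `ℤⁿ`. A preimage of `P` is a finite geometric series
applied to `P`, whose remainder contains a power of `diff x.1` that kills `P`. -/
theorem isUnit_factor {n : ℕ} (x : Fin n × Fin n) : IsUnit (factor x) := by
  rw [Module.End.isUnit_iff]
  constructor
  · rw [injective_iff_map_eq_zero]
    intro P hP
    refine toFn_injective ?_
    rw [map_zero]
    refine (invertibleOn_symb x.1 x.2).eq_zero (locNil_toFn P) ?_
    rw [← toFn_factor, hP, map_zero]
  · intro P
    obtain ⟨N, hN⟩ := exists_diff_pow_eq_zero x.1 P
    have h := one_add_mul_geom_sum_mul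
      ((shift_commute x.2 x.1).sub_right (Commute.one_right _)) N
    refine ⟨(∑ j ∈ Finset.range N, (-(shift x.2 * diff x.1)) ^ j) P, ?_⟩
    have h' := LinearMap.congr_fun h P
    refine h'.trans ?_
    rw [LinearMap.sub_apply, Module.End.mul_apply]
    change P - _ = P
    erw [hN]
    rw [map_zero, sub_zero]

theorem prodOp_mul_prodInvOp (n : ℕ) : prodOp n * prodInvOp n = 1 :=
  noncommProd_mul_noncommProd_inverse _ _ isUnit_factor factor_commute _ _

end MonTri

/-! ### The Vandermonde product as a binomial determinant. -/

namespace MonTri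

open MvPolynomial

theorem prod_pairs {R : Type*} [CommMonoid R] {n : ℕ} (g : Fin n → Fin n → R) :
    ∏ x ∈ pairs n, g x.1 x.2 = ∏ i, ∏ j ∈ Finset.Ioi i, g i j := by
  rw [pairs, Finset.prod_filter, ← Finset.univ_product_univ, Finset.prod_product]
  refine Finset.prod_congr rfl fun i _ => ?_
  rw [← Finset.prod_filter]
  refine Finset.prod_congr ?_ fun _ _ => rfl
  ext j
  simp

/-- Multiplying column `j` by `j!` produces falling factorials, which are monic of degree `j` and so
have the Vandermonde determinant. -/
theorem prod_factorial_mul_chooseDet (n : ℕ) (k : Fin n → ℤ) :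
    (∏ j : Fin n, (Nat.factorial j : ℤ)) * chooseDet 0 n k =
      ∏ x ∈ pairs n, (k x.2 - k x.1) := by
  rw [prod_pairs (fun i j => k j - k i), ← Matrix.det_vandermonde,
    Matrix.det_eval_matrixOfPolynomials_eq_det_vandermonde k (fun j => descPochhammer ℤ j)
    (fun j => descPochhammer_natDegree ℤ j) (fun j => monic_descPochhammer ℤ j), chooseDet,
    ← Matrix.det_mul_row]
  congr 1
  ext i j
  simp only [Matrix.of_apply, add_zero]
  have := Ring.descPochhammer_eq_factorial_smul_choose (k i) (j : ℕ)
  rw [← Polynomial.eval_eq_smeval, nsmul_eq_mul] at this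
  rw [this]

/-- The matrix is unitriangular. Together with `prod_factorial_mul_chooseDet` this identifies `∏ j!`
with the denominator `∏ (j - i)`. -/
theorem chooseDet_val (n : ℕ) : chooseDet 0 n (fun i => ((i : ℕ) : ℤ)) = 1 := by
  rw [chooseDet, Matrix.det_of_isLowerTriangular]
  · simp [Ring.choose_natCast]
  · intro i j hij
    have : (i : ℕ) < j := hij
    simp [Ring.choose_natCast, Nat.choose_eq_zero_of_lt this]

theorem evalInt_vandermonde (n : ℕ) (k : Fin n → ℤ) :
    evalInt k (vandermonde n) = (chooseDet 0 n k : ℂ) := by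
  have h1 := prod_factorial_mul_chooseDet n k
  have h2 := prod_factorial_mul_chooseDet n (fun i => ((i : ℕ) : ℤ))
  rw [chooseDet_val, mul_one] at h2
  have h0 : (∏ j : Fin n, (Nat.factorial j : ℂ)) ≠ 0 :=
    Finset.prod_ne_zero_iff.mpr fun j _ => by exact_mod_cast Nat.factorial_ne_zero _
  have h1' : (∏ j : Fin n, (Nat.factorial j : ℂ)) * (chooseDet 0 n k : ℂ) =
      ∏ x ∈ pairs n, ((k x.2 : ℂ) - k x.1) := by exact_mod_cast h1
  have h2' : ∏ j : Fin n, (Nat.factorial j : ℂ) =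
      ∏ x ∈ pairs n, (((x.2 : ℕ) : ℂ) - ((x.1 : ℕ) : ℂ)) := by exact_mod_cast h2
  have : evalInt k (vandermonde n) = (∏ x ∈ pairs n, (((x.2 : ℕ) : ℂ) - ((x.1 : ℕ) : ℂ)))⁻¹ *
      ∏ x ∈ pairs n, ((k x.2 : ℂ) - k x.1) := by
    simp [evalInt, vandermonde, Finset.prod_mul_distrib]
  rw [this, ← h2', ← h1', inv_mul_cancel_left₀ h0]

theorem prodOp_prodInvOp_vandermonde (n : ℕ) :
    prodOp n (prodInvOp n (vandermonde n)) = vandermonde n :=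
  LinearMap.congr_fun (prodOp_mul_prodInvOp n) _

/-- Both sides are locally nilpotent and have the same image under `symbProd (n + 1)`, which is
injective on such functions. -/
theorem alpha_eq_evalInt (n : ℕ) (k : Fin (n + 1) → ℤ) :
    (alpha (n + 1) k : ℂ) = evalInt k (prodInvOp (n + 1) (vandermonde (n + 1))) := by
  obtain ⟨h1, h2⟩ := alpha_spec n
  have h := (invertibleOn_symbProd (M := ℂ) (n + 1)).injective (h1.map (Int.castAddHom ℂ))
    (locNil_toFn (prodInvOp (n + 1) (vandermonde (n + 1)))) (by
      rw [act_map, h2, ← toFn_prodOp, prodOp_prodInvOp_vandermonde]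
      funext k
      rw [toFn_apply, evalInt_vandermonde]
      rfl)
  exact congrFun h k

end MonTri

/-! ### Counting monotone triangles by removal of the bottom row. -/

namespace MonTri

/-- The bottom row of a monotone triangle. -/
def MonotoneTriangle.bottomRow {n : ℕ} (t : MonotoneTriangle n) : Fin n → ℤ :=
  fun j => t.entry n ((j : ℕ) + 1)

theorem MonotoneTriangle.hasBottomRow_iff {n : ℕ} (t : MonotoneTriangle n) (k : Fin n → ℤ) :
    t.HasBottomRow k ↔ t.bottomRow = k := funext_iff.symm

/-- The row `l` may stand above the row `k`; if `s` holds, strictly in southeast direction. -/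
def Interlaces (s : Prop) {n : ℕ} (k : Fin (n + 1) → ℤ) (l : Fin n → ℤ) : Prop :=
  StrictMono l ∧ ∀ i, k i.castSucc ≤ l i ∧ l i ≤ k i.succ ∧ (s → l i < k i.succ)

open scoped Classical in
/-- The set of rows that may stand above the row `k`. -/
noncomputable def interlacing (s : Prop) {n : ℕ} (k : Fin (n + 1) → ℤ) : Finset (Fin n → ℤ) :=
  (Fintype.piFinset fun i : Fin n => Finset.Icc (k i.castSucc) (k i.succ)).filter (Interlaces s k)

theorem mem_interlacing {s : Prop} {n : ℕ} {k : Fin (n + 1) → ℤ} {l : Fin n → ℤ} :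
    l ∈ interlacing s k ↔ Interlaces s k l := by
  classical
  rw [interlacing, Finset.mem_filter, and_iff_right_iff_imp]
  intro h
  rw [Fintype.mem_piFinset]
  exact fun i => Finset.mem_Icc.mpr ⟨(h.2 i).1, (h.2 i).2.1⟩

theorem MonotoneTriangle.strictMono_bottomRow {n : ℕ} (t : MonotoneTriangle n) :
    StrictMono t.bottomRow := by
  cases n with
  | zero => exact fun i => i.elim0
  | succ n =>
    exact Fin.strictMono_iff_lt_succ.mpr fun i =>
      t.row_strict (n + 1) (i + 1) (by omega) (by omega) le_rfl

/-- Removal of the bottom row. -/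
def MonotoneTriangle.trunc {n : ℕ} (t : MonotoneTriangle (n + 1)) : MonotoneTriangle n where
  entry i j := if i ≤ n then t.entry i j else 0
  northeast i j h1 h2 h3 := by
    rw [if_pos h3, if_pos (by omega)]
    exact t.northeast i j h1 h2 (by omega)
  southeast i j h1 h2 h3 := by
    rw [if_pos h3, if_pos (by omega)]
    exact t.southeast i j h1 h2 (by omega)
  row_strict i j h1 h2 h3 := by
    rw [if_pos h3, if_pos h3]
    exact t.row_strict i j h1 h2 (by omega)
  zeros i j h := by
    split_ifs with hi
    · exact t.zeros i j (by omega)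
    · rfl

/-- The triangle with a further row `k` below. -/
def MonotoneTriangle.extend {n : ℕ} (t : MonotoneTriangle n) (k : Fin (n + 1) → ℤ)
    (hk : StrictMono k) (h : ∀ i, k i.castSucc ≤ t.bottomRow i ∧ t.bottomRow i ≤ k i.succ) :
    MonotoneTriangle (n + 1) where
  entry i j := if i = n + 1 then (if hj : 1 ≤ j ∧ j ≤ n + 1 then k ⟨j - 1, by omega⟩ else 0)
    else t.entry i j
  northeast i j h1 h2 h3 := by
    rw [if_neg (show ¬ i = n + 1 by omega)]
    split_ifs with hi hj
    · obtain rfl : i = n := by omega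
      obtain ⟨j, rfl⟩ : ∃ j', j = j' + 1 := ⟨j - 1, by omega⟩
      exact (h ⟨j, by omega⟩).1
    · omega
    · exact t.northeast i j h1 h2 (by omega)
  southeast i j h1 h2 h3 := by
    rw [if_neg (show ¬ i = n + 1 by omega)]
    split_ifs with hi hj
    · obtain rfl : i = n := by omega
      obtain ⟨j, rfl⟩ : ∃ j', j = j' + 1 := ⟨j - 1, by omega⟩
      exact (h ⟨j, by omega⟩).2
    · omega
    · exact t.southeast i j h1 h2 (by omega)
  row_strict i j h1 h2 h3 := by
    split_ifs with hi hj hj' hj'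
    · exact hk (Fin.mk_lt_mk.mpr (by omega))
    · omega
    · omega
    · omega
    · exact t.row_strict i j h1 h2 (by omega)
  zeros i j hz := by
    split_ifs with hi hj
    · omega
    · rfl
    · exact t.zeros i j (by omega)

/-- Removal of the bottom row `k` as a bijection. -/
def truncEquiv (s : Prop) {n : ℕ} (k : Fin (n + 1) → ℤ) (hk : StrictMono k) :
    {t : MonotoneTriangle (n + 1) // t.bottomRow = k ∧ (s → t.StrictSoutheast)} ≃
      {t : MonotoneTriangle n // t.bottomRow ∈ interlacing s k ∧ (s → t.StrictSoutheast)} where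
  toFun t := ⟨t.1.trunc, by
    obtain ⟨t, rfl, hs⟩ := t
    have hrow : ∀ i : Fin n, t.trunc.bottomRow i = t.entry n (i + 1) := fun i => if_pos le_rfl
    refine ⟨mem_interlacing.mpr ⟨t.trunc.strictMono_bottomRow, fun i => ?_⟩, fun hs' => ?_⟩
    · rw [hrow]
      exact ⟨t.northeast n (i + 1) (by omega) (by omega) (by omega),
        t.southeast n (i + 1) (by omega) (by omega) (by omega),
        fun h => hs h n (i + 1) (by omega) (by omega) (by omega)⟩
    · intro i j h1 h2 h3
      simp only [MonotoneTriangle.trunc]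
      rw [if_pos h3, if_pos (by omega)]
      exact hs hs' i j h1 h2 (by omega)⟩
  invFun t := ⟨t.1.extend k hk fun i =>
      ⟨((mem_interlacing.mp t.2.1).2 i).1, ((mem_interlacing.mp t.2.1).2 i).2.1⟩, by
    obtain ⟨t, ht, hs⟩ := t
    rw [mem_interlacing] at ht
    constructor
    · funext j
      simp only [MonotoneTriangle.bottomRow, MonotoneTriangle.extend]
      rw [if_pos trivial, dif_pos (by omega)]
      rfl
    · intro hs' i j h1 h2 h3
      simp only [MonotoneTriangle.extend]
      rw [if_neg (show ¬ i = n + 1 by omega)]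
      split_ifs with hi hj
      · obtain rfl : i = n := by omega
        obtain ⟨j, rfl⟩ : ∃ j', j = j' + 1 := ⟨j - 1, by omega⟩
        exact (ht.2 ⟨j, by omega⟩).2.2 hs'
      · omega
      · exact hs hs' i j h1 h2 (by omega)⟩
  left_inv := by
    rintro ⟨t, rfl, hs⟩
    apply Subtype.ext
    ext i j
    simp only [MonotoneTriangle.extend, MonotoneTriangle.trunc, MonotoneTriangle.bottomRow]
    split_ifs with h1 h2 h3
    · subst h1
      congr 1
      omega
    · exact (t.zeros i j (by omega)).symm
    · rfl
    · exact (t.zeros i j (by omega)).symm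
  right_inv := by
    rintro ⟨t, ht⟩
    apply Subtype.ext
    ext i j
    simp only [MonotoneTriangle.extend, MonotoneTriangle.trunc]
    split_ifs with h1 h2 h3
    · omega
    · omega
    · rfl
    · exact (t.zeros i j (by omega)).symm

/-- A type fibred over a finite set. -/
def fiberEquiv {α β : Type*} (f : α → β) (p : α → Prop) (S : Finset β) :
    {t // f t ∈ S ∧ p t} ≃ Σ l : S, {t // f t = l ∧ p t} where
  toFun t := ⟨⟨f t.1, t.2.1⟩, ⟨t.1, rfl, t.2.2⟩⟩
  invFun x := ⟨x.2.1, by rw [x.2.2.1]; exact x.1.2, x.2.2.2⟩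
  left_inv _ := rfl
  right_inv := by
    rintro ⟨⟨l, hl⟩, ⟨t, ht, hp⟩⟩
    cases (show f t = l from ht)
    rfl

theorem finite_triangles (s : Prop) (n : ℕ) (k : Fin n → ℤ) (hk : StrictMono k) :
    Finite {t : MonotoneTriangle n // t.bottomRow = k ∧ (s → t.StrictSoutheast)} := by
  induction n with
  | zero =>
    have : Subsingleton (MonotoneTriangle 0) := ⟨fun t t' => by
      ext i j
      rw [t.zeros i j (by omega), t'.zeros i j (by omega)]⟩
    infer_instance
  | succ n ih =>
    have : ∀ l : interlacing s k, Finite {t : MonotoneTriangle n //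
        t.bottomRow = l ∧ (s → t.StrictSoutheast)} :=
      fun l => ih l (mem_interlacing.mp l.2).1
    exact Finite.of_equiv _ ((truncEquiv s k hk).trans (fiberEquiv _ _ _)).symm

theorem card_triangles_succ (s : Prop) (n : ℕ) (k : Fin (n + 1) → ℤ) (hk : StrictMono k) :
    Nat.card {t : MonotoneTriangle (n + 1) // t.bottomRow = k ∧ (s → t.StrictSoutheast)} =
      ∑ l ∈ interlacing s k,
        Nat.card {t : MonotoneTriangle n // t.bottomRow = l ∧ (s → t.StrictSoutheast)} := by
  have : ∀ l : interlacing s k, Finite {t : MonotoneTriangle n //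
      t.bottomRow = l ∧ (s → t.StrictSoutheast)} :=
    fun l => finite_triangles s n l (mem_interlacing.mp l.2).1
  rw [Nat.card_congr ((truncEquiv s k hk).trans (fiberEquiv _ _ _)), Nat.card_sigma,
    Finset.sum_coe_sort (interlacing s k) fun l =>
      Nat.card {t : MonotoneTriangle n // t.bottomRow = l ∧ (s → t.StrictSoutheast)}]

theorem card_triangles_zero (s : Prop) (k : Fin 0 → ℤ) :
    Nat.card {t : MonotoneTriangle 0 // t.bottomRow = k ∧ (s → t.StrictSoutheast)} = 1 := by
  rw [Nat.card_eq_one_iff_unique]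
  refine ⟨⟨fun t t' => Subtype.ext ?_⟩, ⟨⟨⟨fun _ _ => 0, ?_, ?_, ?_, ?_⟩, ?_, ?_⟩⟩⟩
  · ext i j
    rw [t.1.zeros i j (by omega), t'.1.zeros i j (by omega)]
  · intros; omega
  · intros; omega
  · intros; omega
  · intros; rfl
  · exact Subsingleton.elim _ _
  · intro _ i j; omega

/-- The parameter `s` treats both counts at once: `False` switches the southeast condition off,
`True` imposes it. -/
theorem countMT_eq (n : ℕ) (k : Fin n → ℤ) : countMT n k =
    Nat.card {t : MonotoneTriangle n // t.bottomRow = k ∧ (False → t.StrictSoutheast)} :=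
  Nat.card_congr (Equiv.subtypeEquivRight fun t => by simp [t.hasBottomRow_iff])

theorem countStrictMT_eq (n : ℕ) (k : Fin n → ℤ) : countStrictMT n k =
    Nat.card {t : MonotoneTriangle n // t.bottomRow = k ∧ (True → t.StrictSoutheast)} :=
  Nat.card_congr (Equiv.subtypeEquivRight fun t => by simp [t.hasBottomRow_iff])

theorem strictMono_consZ {n : ℕ} {x : ℤ} {l : Fin n → ℤ} :
    StrictMono (consZ x l) ↔ (∀ i, x < l i) ∧ StrictMono l := by
  constructor
  · intro h
    exact ⟨fun i => h (Fin.succ_pos i), fun i j hij => h (Fin.succ_lt_succ_iff.mpr hij)⟩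
  · rintro ⟨h1, h2⟩ i j hij
    cases j using Fin.cases with
    | zero => exact absurd hij (Fin.not_lt_zero _)
    | succ j =>
      cases i using Fin.cases with
      | zero => exact h1 j
      | succ i => exact h2 (Fin.succ_lt_succ_iff.mp hij)

theorem interlaces_consZ {s : Prop} {n : ℕ} {a b x : ℤ} {K l : Fin n → ℤ} :
    Interlaces s (consZ a (consZ b K)) (consZ x l) ↔
      (a ≤ x ∧ x ≤ b ∧ (s → x < b)) ∧ (∀ i, x < l i) ∧ Interlaces s (consZ b K) l := by
  unfold Interlaces
  rw [Fin.forall_fin_succ, strictMono_consZ]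
  simp only [Fin.castSucc_zero, Fin.cons_zero, Fin.cons_succ, ← Fin.succ_castSucc]
  tauto

/-- The first entry is only required to be at most the others: `rowSum_cons` replaces `b` by `b +
1`, which may equal the next entry, and the induction must cover that case. -/
theorem rowSum_eq_sum (n : ℕ) (a : ℤ) (K : Fin n → ℤ) (hK : StrictMono K) (ha : ∀ i, a ≤ K i)
    (A : (Fin n → ℤ) → ℤ) :
    rowSum n (consZ a K) A = ∑ l ∈ interlacing False (consZ a K), A l := by
  induction n generalizing a with
  | zero =>
    have : interlacing False (consZ a K) = {![]} := by
      ext l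
      rw [mem_interlacing, Finset.mem_singleton]
      exact ⟨fun _ => Subsingleton.elim _ _, fun _ => ⟨fun i => i.elim0, fun i => i.elim0⟩⟩
    rw [this, Finset.sum_singleton, rowSum]
  | succ n ih =>
    obtain ⟨b, K, rfl⟩ : ∃ b K', K = consZ b K' := ⟨K 0, Fin.tail K, (Fin.cons_self_tail K).symm⟩
    obtain ⟨hbK, hK⟩ := strictMono_consZ.mp hK
    have hab : a ≤ b := ha 0
    rw [rowSum_cons, extSum_of_le (by omega), ih (b + 1) K hK hbK]
    simp_rw [ih b K hK fun i => (hbK i).le]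
    -- The possible continuations of a row with first entry `x`. For `x < b` strictness after `x` is
    -- automatic; for `x = b` it amounts to raising the lower bound of the next entry.
    set J : ℤ → Finset (Fin n → ℤ) := fun x =>
      if x < b then interlacing False (consZ b K) else interlacing False (consZ (b + 1) K)
      with hJ
    have hge : ∀ c, (∀ i, c ≤ K i) → ∀ i : Fin n, c ≤ consZ c K i.castSucc := by
      intro c hc i
      generalize i.castSucc = j
      cases j using Fin.cases with
      | zero => simp
      | succ j => simpa using hc j
    have hmem : ∀ x l, consZ x l ∈ interlacing False (consZ a (consZ b K)) ↔
        x ∈ Finset.Icc a b ∧ l ∈ J x := by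
      intro x l
      rw [mem_interlacing, interlaces_consZ, Finset.mem_Icc, hJ]
      simp only [false_imp_iff, and_true]
      refine and_congr_right fun hx => ?_
      by_cases hxb : x < b
      · rw [if_pos hxb, mem_interlacing, and_iff_right_iff_imp]
        intro h i
        have := hge b (fun i => (hbK i).le) i
        have := (h.2 i).1
        omega
      · obtain rfl : x = b := by omega
        rw [if_neg hxb, mem_interlacing]
        unfold Interlaces
        constructor
        · rintro ⟨h1, h2, h3⟩
          refine ⟨h2, fun i => ⟨?_, (h3 i).2⟩⟩
          have h4 := (h3 i).1
          have h5 := h1 i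
          generalize i.castSucc = j at h4 ⊢
          cases j using Fin.cases with
          | zero => simpa using h5
          | succ j => simpa using h4
        · rintro ⟨h2, h3⟩
          refine ⟨fun i => ?_, h2, fun i => ⟨?_, (h3 i).2⟩⟩
          · have := hge (x + 1) hbK i
            have := (h3 i).1
            omega
          · have h4 := (h3 i).1
            generalize i.castSucc = j at h4 ⊢
            cases j using Fin.cases with
            | zero => simp at h4 ⊢; omega
            | succ j => simpa using h4
    have h1 : ∑ x ∈ Finset.Icc a b, ∑ l ∈ J x, A (consZ x l) =
        ∑ l ∈ interlacing False (consZ a (consZ b K)), A l := by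
      rw [Finset.sum_sigma']
      refine Finset.sum_bij' (fun x _ => consZ x.1 x.2) (fun l _ => ⟨l 0, Fin.tail l⟩)
        ?_ ?_ ?_ ?_ ?_
      · rintro ⟨x, l⟩ h
        rw [Finset.mem_sigma] at h
        exact (hmem x l).mpr h
      · intro l h
        rw [Finset.mem_sigma]
        refine (hmem _ _).mp ?_
        change Fin.cons (l 0) (Fin.tail l) ∈ _
        rwa [Fin.cons_self_tail]
      · rintro ⟨x, l⟩ _
        rfl
      · intro l _
        exact Fin.cons_self_tail l
      · rintro ⟨x, l⟩ _
        rfl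
    rw [← h1, ← Finset.insert_Icc_sub_one_right_eq_Icc hab, Finset.sum_insert (by simp), add_comm]
    congr 1
    · simp [hJ, slice]
    · refine Finset.sum_congr rfl fun x hx => ?_
      rw [hJ]
      simp only
      rw [if_pos (by rw [Finset.mem_Icc] at hx; omega)]
      rfl

theorem countMT_eq_alpha (n : ℕ) (k : Fin n → ℤ) (hk : StrictMono k) :
    (countMT n k : ℤ) = alpha n k := by
  induction n with
  | zero => rw [countMT_eq, card_triangles_zero]; rfl
  | succ n ih =>
    have h1 : alpha (n + 1) k = rowSum n k (alpha n) := by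
      cases n with
      | zero => simp [alpha, rowSum]
      | succ n => rw [alpha]
    obtain ⟨a, K, rfl⟩ : ∃ a K, k = consZ a K := ⟨k 0, Fin.tail k, (Fin.cons_self_tail k).symm⟩
    obtain ⟨h2, h3⟩ := strictMono_consZ.mp hk
    rw [h1, rowSum_eq_sum n a K h3 (fun i => (h2 i).le), countMT_eq, card_triangles_succ _ _ _ hk,
      Nat.cast_sum]
    refine Finset.sum_congr rfl fun l hl => ?_
    rw [← countMT_eq, ih l (mem_interlacing.mp hl).1]

/-! ### Triangles strictly increasing in southeast direction. -/

theorem sum_Ico_ringChoose {a b : ℤ} (h : a ≤ b) (j : ℕ) :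
    ∑ x ∈ Finset.Ico a b, Ring.choose x j = Ring.choose b (j + 1) - Ring.choose a (j + 1) := by
  induction b, h using Int.leInduction with
  | base => simp
  | succ b hb ih =>
    rw [← Finset.insert_Ico_right_eq_Ico_add_one hb, Finset.sum_insert (by simp), ih,
      Ring.choose_succ_succ]
    ring

/-- Subtracting from each row its predecessor turns the first column of ones into `(1, 0, …, 0)`. -/
theorem chooseDet_succ (n : ℕ) (k : Fin (n + 1) → ℤ) : chooseDet 0 (n + 1) k =
    (Matrix.of fun i j : Fin n => Ring.choose (k i.succ) ((j : ℕ) + 1) -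
      Ring.choose (k i.castSucc) ((j : ℕ) + 1)).det := by
  have h : chooseDet 0 (n + 1) k = (Matrix.of fun i j : Fin (n + 1) =>
      (Fin.cases (Ring.choose (k 0) (j : ℕ)) (fun i => Ring.choose (k i.succ) (j : ℕ) -
        Ring.choose (k i.castSucc) (j : ℕ)) i : ℤ)).det := by
    refine Matrix.det_eq_of_forall_row_eq_smul_add_pred (fun _ => 1) ?_ ?_
    · intro j; simp
    · intro i j; simp
  rw [h, Matrix.det_succ_column_zero, Fin.sum_univ_succ]
  simp only [Matrix.of_apply, Fin.val_zero, Ring.choose_zero_right, sub_self, Fin.cases_succ,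
    Fin.cases_zero, mul_zero, zero_mul, Finset.sum_const_zero, add_zero, pow_zero, one_mul]
  rfl

/-- Strictness in southeast direction already forces the upper row to increase, since the half-open
intervals are disjoint and ordered. The entries can thus be chosen independently. -/
theorem interlacing_true_eq {n : ℕ} {k : Fin (n + 1) → ℤ} (hk : StrictMono k) :
    interlacing True k =
      Fintype.piFinset fun i : Fin n => Finset.Ico (k i.castSucc) (k i.succ) := by
  ext l
  rw [mem_interlacing, Fintype.mem_piFinset]
  simp only [Finset.mem_Ico]
  constructor
  · exact fun h i => ⟨(h.2 i).1, (h.2 i).2.2 trivial⟩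
  · intro h
    refine ⟨fun i j hij => ?_, fun i => ⟨(h i).1, (h i).2.le, fun _ => (h i).2⟩⟩
    have h1 : k i.succ ≤ k j.castSucc := hk.monotone (by rw [Fin.le_def]; exact hij)
    have := h i
    have := h j
    omega

/-- Over a box, each Leibniz term sums coordinate by coordinate. The telescoping sums of binomial
coefficients are the entries in `chooseDet_succ`. -/
theorem sum_interlacing_chooseDet (n : ℕ) (k : Fin (n + 1) → ℤ) (hk : StrictMono k) :
    ∑ l ∈ interlacing True k, chooseDet 0 n l = chooseDet 0 (n + 1) k := by
  rw [interlacing_true_eq hk, chooseDet_succ, ← Matrix.det_transpose, Matrix.det_apply',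
    chooseDet_eq_sum]
  simp only [Finset.sum_apply, Pi.smul_apply]
  rw [Finset.sum_comm]
  refine Finset.sum_congr rfl fun σ _ => ?_
  rw [← Finset.smul_sum, smul_eq_mul]
  congr 1
  simp only [prodFn, Matrix.transpose_apply, Matrix.of_apply, add_zero]
  refine (Finset.prod_univ_sum (fun i : Fin n => Finset.Ico (k i.castSucc) (k i.succ))
    (fun i x => Ring.choose x (σ i : ℕ))).symm.trans ?_
  exact Finset.prod_congr rfl fun i _ => sum_Ico_ringChoose
    (hk (Fin.castSucc_lt_succ)).le _

theorem countStrictMT_eq_chooseDet (n : ℕ) (k : Fin n → ℤ) (hk : StrictMono k) :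
    (countStrictMT n k : ℤ) = chooseDet 0 n k := by
  induction n with
  | zero => rw [countStrictMT_eq, card_triangles_zero]; simp [chooseDet]
  | succ n ih =>
    rw [countStrictMT_eq, card_triangles_succ _ _ _ hk, Nat.cast_sum,
      ← sum_interlacing_chooseDet n k hk]
    refine Finset.sum_congr rfl fun l hl => ?_
    rw [← countStrictMT_eq, ih l (mem_interlacing.mp hl).1]

end MonTri

/-! ### Semistandard tableaux and strict triangles. -/

namespace MonTri

/-- A downward closed subset of `{0, …, m - 1}` is an initial segment, so its cardinality determines
membership. It is applied to the entries less than `i` in a row of a tableau. -/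
theorem lt_card_filter_range_iff {m c : ℕ} (p : ℕ → Prop) [DecidablePred p]
    (hp : ∀ a b, a < b → b < m → p b → p a) (hc : c < m) :
    p c ↔ c < ((Finset.range m).filter p).card := by
  constructor
  · intro h
    have : Finset.range (c + 1) ⊆ (Finset.range m).filter p := by
      intro a ha
      rw [Finset.mem_range] at ha
      rw [Finset.mem_filter, Finset.mem_range]
      refine ⟨by omega, ?_⟩
      rcases Nat.lt_succ_iff_lt_or_eq.mp ha with h1 | rfl
      · exact hp a c h1 hc h
      · exact h
    simpa using Finset.card_le_card this
  · intro h
    by_contra hpc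
    have : (Finset.range m).filter p ⊆ Finset.range c := by
      intro a ha
      rw [Finset.mem_filter, Finset.mem_range] at ha
      rw [Finset.mem_range]
      by_contra hac
      rcases Nat.lt_or_eq_of_le (Nat.le_of_not_lt hac) with h1 | rfl
      · exact hpc (hp c a h1 ha.1 ha.2)
      · exact hpc ha.2
    have := Finset.card_le_card this
    rw [Finset.card_range] at this
    omega

/-- The length of the `r`-th row of the part of the tableau `T` with entries less than `i`. -/
def rowLenLT {μ : YoungDiagram} (T : SemistandardYoungTableau μ) (i r : ℕ) : ℕ :=
  ((Finset.range (μ.rowLen r)).filter fun c => T r c < i).card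

theorem lt_rowLenLT_iff {μ : YoungDiagram} (T : SemistandardYoungTableau μ) {i r c : ℕ}
    (hc : (r, c) ∈ μ) : T r c < i ↔ c < rowLenLT T i r :=
  lt_card_filter_range_iff (fun c => T r c < i)
    (fun _ _ hab hb h => lt_of_le_of_lt
      (T.row_weak hab (YoungDiagram.mem_iff_lt_rowLen.mpr hb)) h)
    (YoungDiagram.mem_iff_lt_rowLen.mp hc)

theorem mem_of_lt_rowLenLT {μ : YoungDiagram} (T : SemistandardYoungTableau μ) {i r c : ℕ}
    (hc : c < rowLenLT T i r) : (r, c) ∈ μ := by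
  rw [YoungDiagram.mem_iff_lt_rowLen]
  refine hc.trans_le ((Finset.card_filter_le _ _).trans ?_)
  rw [Finset.card_range]

theorem rowLenLT_le_of {μ : YoungDiagram} (T : SemistandardYoungTableau μ) {i r i' r' : ℕ}
    (h : ∀ c, (r, c) ∈ μ → T r c < i → (r', c) ∈ μ ∧ T r' c < i') :
    rowLenLT T i r ≤ rowLenLT T i' r' := by
  by_contra hlt
  push Not at hlt
  have hm := mem_of_lt_rowLenLT T hlt
  obtain ⟨h1, h2⟩ := h _ hm ((lt_rowLenLT_iff T hm).mpr hlt)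
  exact lt_irrefl _ ((lt_rowLenLT_iff T h1).mp h2)

/-- Columns increase strictly from a nonnegative start. Hence entries less than `i` lie in the first
`i` rows, and row `i` of the triangle has room for the whole shape. -/
theorem le_tableau_entry {μ : YoungDiagram} (T : SemistandardYoungTableau μ) {r c : ℕ}
    (h : (r, c) ∈ μ) : r ≤ T r c := by
  induction r with
  | zero => exact Nat.zero_le _
  | succ r ih =>
    have h1 := ih (μ.up_left_mem (Nat.le_succ r) le_rfl h)
    have h2 := T.col_strict (Nat.lt_add_one r) h
    omega

/-- The monotone triangle of a semistandard tableau with entries less than `n`. -/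
def tableauTriangle {μ : YoungDiagram} (T : SemistandardYoungTableau μ) (n : ℕ) :
    MonotoneTriangle n where
  entry i j := if 1 ≤ j ∧ j ≤ i ∧ i ≤ n then rowLenLT T i (i - j) + (j : ℤ) else 0
  northeast i j h1 h2 h3 := by
    rw [if_pos (by omega), if_pos (by omega)]
    have : rowLenLT T (i + 1) (i + 1 - j) ≤ rowLenLT T i (i - j) := by
      rw [Nat.sub_add_comm h2]
      refine rowLenLT_le_of T fun c hc h => ⟨μ.up_left_mem (Nat.le_succ _) le_rfl hc, ?_⟩
      have := T.col_strict (Nat.lt_add_one (i - j)) hc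
      omega
    omega
  southeast i j h1 h2 h3 := by
    rw [if_pos (by omega), if_pos (by omega), Nat.add_sub_add_right]
    have : rowLenLT T i (i - j) ≤ rowLenLT T (i + 1) (i - j) :=
      rowLenLT_le_of T fun c hc h => ⟨hc, by omega⟩
    push_cast
    omega
  row_strict i j h1 h2 h3 := by
    rw [if_pos (by omega), if_pos (by omega)]
    have : rowLenLT T i (i - j) ≤ rowLenLT T i (i - (j + 1)) := by
      obtain ⟨r, hr⟩ : ∃ r, i - j = r + 1 := ⟨i - j - 1, by omega⟩
      rw [hr, show i - (j + 1) = r by omega]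
      refine rowLenLT_le_of T fun c hc h => ⟨μ.up_left_mem (Nat.le_succ _) le_rfl hc, ?_⟩
      have := T.col_strict (Nat.lt_add_one r) hc
      omega
    push_cast
    omega
  zeros i j h := if_neg h

theorem tableauTriangle_strictSoutheast {μ : YoungDiagram} (T : SemistandardYoungTableau μ)
    (n : ℕ) : (tableauTriangle T n).StrictSoutheast := by
  intro i j h1 h2 h3
  simp only [tableauTriangle]
  rw [if_pos (by omega), if_pos (by omega), Nat.add_sub_add_right]
  have : rowLenLT T i (i - j) ≤ rowLenLT T (i + 1) (i - j) :=
    rowLenLT_le_of T fun c hc h => ⟨hc, by omega⟩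
  push_cast
  omega

/-- The shape in row `i` of a triangle: its `r`-th part is `a_{i, i - r} - (i - r)`. -/
def MonotoneTriangle.part {n : ℕ} (t : MonotoneTriangle n) (i r : ℕ) : ℤ :=
  if r < i then t.entry i (i - r) - ((i - r : ℕ) : ℤ) else 0

theorem part_tableauTriangle {μ : YoungDiagram} (T : SemistandardYoungTableau μ) {n i : ℕ}
    (hi : i ≤ n) (r : ℕ) : (tableauTriangle T n).part i r = rowLenLT T i r := by
  unfold MonotoneTriangle.part
  split_ifs with h
  · simp only [tableauTriangle]
    rw [if_pos (by omega), Nat.sub_sub_self h.le]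
    ring
  · rw [eq_comm, Nat.cast_eq_zero, rowLenLT, Finset.card_eq_zero, Finset.filter_eq_empty_iff]
    intro c hc
    have := le_tableau_entry T (YoungDiagram.mem_iff_lt_rowLen.mpr (Finset.mem_range.mp hc))
    omega

theorem MonotoneTriangle.ext_part {n : ℕ} {t t' : MonotoneTriangle n}
    (h : ∀ i r, i ≤ n → t.part i r = t'.part i r) : t = t' := by
  ext i j
  by_cases hij : 1 ≤ j ∧ j ≤ i ∧ i ≤ n
  · have := h i (i - j) hij.2.2
    unfold MonotoneTriangle.part at this
    rw [if_pos (by omega), if_pos (by omega), Nat.sub_sub_self hij.2.1] at this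
    omega
  · rw [t.zeros i j hij, t'.zeros i j hij]

/-- The bottom row of triangles that correspond to tableaux of shape `μ`. -/
def shapeRow (n : ℕ) (μ : YoungDiagram) (i : Fin n) : ℤ :=
  (μ.rowLen (i.rev : ℕ) : ℤ) + ((i : ℕ) + 1)

theorem strictMono_shapeRow (n : ℕ) (μ : YoungDiagram) : StrictMono (shapeRow n μ) := by
  intro i j hij
  have h : μ.rowLen (i.rev : ℕ) ≤ μ.rowLen (j.rev : ℕ) :=
    μ.rowLen_anti _ _ (Fin.rev_le_rev.mpr hij.le)
  have : (i : ℕ) < j := hij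
  unfold shapeRow
  omega

section Part

variable {n : ℕ} {μ : YoungDiagram} {t : MonotoneTriangle n}

theorem rowLen_eq_zero_of_le {r : ℕ} (hμ : μ.colLen 0 ≤ r) : μ.rowLen r = 0 := by
  by_contra h
  have h1 : (r, 0) ∈ μ := YoungDiagram.mem_iff_lt_rowLen.mpr (Nat.pos_of_ne_zero h)
  have := YoungDiagram.mem_iff_lt_colLen.mp h1
  omega

theorem part_bottom (hμ : μ.colLen 0 ≤ n) (ht : t.HasBottomRow (shapeRow n μ)) (r : ℕ) :
    t.part n r = μ.rowLen r := by
  unfold MonotoneTriangle.part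
  split_ifs with h
  · have := ht ⟨n - r - 1, by omega⟩
    simp only [shapeRow, Fin.val_rev] at this
    rw [show n - r - 1 + 1 = n - r by omega, Nat.sub_sub_self h.le] at this
    omega
  · rw [rowLen_eq_zero_of_le (by omega), Nat.cast_zero]

theorem part_succ_succ_le {i : ℕ} (hi : i + 1 ≤ n) (r : ℕ) :
    t.part (i + 1) (r + 1) ≤ t.part i r := by
  unfold MonotoneTriangle.part
  rw [Nat.add_sub_add_right]
  by_cases h : r < i
  · rw [if_pos h, if_pos (by omega)]
    have := t.northeast i (i - r) (by omega) (by omega) hi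
    omega
  · rw [if_neg h, if_neg (by omega)]

/-- Nonnegativity holds in the bottom row and moves upwards along `part_succ_succ_le`. -/
theorem part_nonneg (hμ : μ.colLen 0 ≤ n) (ht : t.HasBottomRow (shapeRow n μ)) {i : ℕ}
    (hi : i ≤ n) (r : ℕ) : 0 ≤ t.part i r := by
  obtain ⟨d, hd⟩ := Nat.exists_eq_add_of_le hi
  induction d generalizing i r with
  | zero =>
    obtain rfl : n = i := hd
    rw [part_bottom hμ ht]
    exact Int.natCast_nonneg _
  | succ d ih =>
    exact (ih (i := i + 1) (by omega) (r + 1) (by omega)).trans (part_succ_succ_le (by omega) r)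

theorem part_le_succ (hμ : μ.colLen 0 ≤ n) (ht : t.HasBottomRow (shapeRow n μ))
    (hs : t.StrictSoutheast) {i : ℕ} (hi : i + 1 ≤ n) (r : ℕ) :
    t.part i r ≤ t.part (i + 1) r := by
  by_cases h : r < i
  · unfold MonotoneTriangle.part
    rw [if_pos h, if_pos (by omega), Nat.sub_add_comm h.le]
    have := hs i (i - r) (by omega) (by omega) hi
    push_cast
    omega
  · have := part_nonneg hμ ht hi r
    rwa [show t.part i r = 0 from if_neg h]

theorem part_mono (hμ : μ.colLen 0 ≤ n) (ht : t.HasBottomRow (shapeRow n μ))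
    (hs : t.StrictSoutheast) {i i' : ℕ} (hi : i ≤ i') (hi' : i' ≤ n) (r : ℕ) :
    t.part i r ≤ t.part i' r := by
  induction i', hi using Nat.le_induction with
  | base => exact le_rfl
  | succ i' _ ih => exact (ih (by omega)).trans (part_le_succ hμ ht hs hi' r)

theorem part_anti (hμ : μ.colLen 0 ≤ n) (ht : t.HasBottomRow (shapeRow n μ))
    (hs : t.StrictSoutheast) {i : ℕ} (hi : i ≤ n) : Antitone (t.part i) := by
  refine antitone_nat_of_succ_le fun r => ?_
  rcases Nat.lt_or_eq_of_le hi with h | rfl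
  · exact (part_le_succ hμ ht hs h _).trans (part_succ_succ_le h r)
  · rw [part_bottom hμ ht, part_bottom hμ ht]
    exact_mod_cast μ.rowLen_anti _ _ (Nat.le_succ r)

/-- The entry in row `r` and column `c` of the tableau of a triangle. -/
noncomputable def triangleEntry (t : MonotoneTriangle n) (r c : ℕ) : ℕ :=
  sInf {m : ℕ | (c : ℤ) < t.part (m + 1) r}

theorem triangleEntry_lt_iff (hμ : μ.colLen 0 ≤ n) (ht : t.HasBottomRow (shapeRow n μ))
    (hs : t.StrictSoutheast) {r c i : ℕ} (hc : (r, c) ∈ μ) (hi : i ≤ n) :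
    triangleEntry t r c < i ↔ (c : ℤ) < t.part i r := by
  have h0 : ∀ i, i ≤ n → (c : ℤ) < t.part i r → triangleEntry t r c < i := by
    intro i _ h
    cases i with
    | zero => rw [show t.part 0 r = 0 from if_neg (Nat.not_lt_zero r)] at h; omega
    | succ m => exact Nat.lt_succ_of_le (Nat.sInf_le h)
  have hcn : (c : ℤ) < t.part n r := by
    rw [part_bottom hμ ht]
    exact_mod_cast YoungDiagram.mem_iff_lt_rowLen.mp hc
  refine ⟨fun h => ?_, h0 i hi⟩
  -- A cell of `μ` forces `n ≥ 1`, and `n - 1` shows that the set in `triangleEntry` is nonempty;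
  -- the default value of `sInf` on the empty set plays no role.
  have hn : n - 1 + 1 = n := by have := h0 n le_rfl hcn; omega
  have hmem : triangleEntry t r c ∈ {m : ℕ | (c : ℤ) < t.part (m + 1) r} :=
    Nat.sInf_mem ⟨n - 1, by rw [Set.mem_ofPred_eq, hn]; exact hcn⟩
  exact lt_of_lt_of_le hmem (part_mono hμ ht hs h hi r)

theorem triangleEntry_lt (hμ : μ.colLen 0 ≤ n) (ht : t.HasBottomRow (shapeRow n μ))
    (hs : t.StrictSoutheast) {r c : ℕ} (hc : (r, c) ∈ μ) : triangleEntry t r c < n := by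
  rw [triangleEntry_lt_iff hμ ht hs hc le_rfl, part_bottom hμ ht]
  exact_mod_cast YoungDiagram.mem_iff_lt_rowLen.mp hc

/-- The tableau of a triangle. -/
noncomputable def triangleTableau (hμ : μ.colLen 0 ≤ n) (ht : t.HasBottomRow (shapeRow n μ))
    (hs : t.StrictSoutheast) : SemistandardYoungTableau μ where
  entry r c := open scoped Classical in if (r, c) ∈ μ then triangleEntry t r c else 0
  row_weak' {r c₁ c₂} hc h2 := by
    have h1 : (r, c₁) ∈ μ := μ.up_left_mem le_rfl hc.le h2
    rw [if_pos h1, if_pos h2, ← Nat.lt_succ_iff]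
    have hn := triangleEntry_lt hμ ht hs h2
    rw [triangleEntry_lt_iff hμ ht hs h1 hn]
    have := (triangleEntry_lt_iff hμ ht hs h2 hn).mp (Nat.lt_add_one _)
    omega
  col_strict' {r₁ r₂ c} hr h2 := by
    have h1 : (r₁, c) ∈ μ := μ.up_left_mem hr.le le_rfl h2
    rw [if_pos h1, if_pos h2]
    have hn := triangleEntry_lt hμ ht hs h2
    rw [triangleEntry_lt_iff hμ ht hs h1 hn.le]
    have h3 := (triangleEntry_lt_iff hμ ht hs h2 hn).mp (Nat.lt_add_one _)
    obtain ⟨r, rfl⟩ : ∃ r, r₂ = r + 1 := ⟨r₂ - 1, by omega⟩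
    exact (h3.trans_le (part_succ_succ_le hn r)).trans_le
      (part_anti hμ ht hs hn.le (Nat.lt_succ_iff.mp hr))
  zeros' h := if_neg h

theorem tableauTriangle_triangleTableau (hμ : μ.colLen 0 ≤ n)
    (ht : t.HasBottomRow (shapeRow n μ)) (hs : t.StrictSoutheast) :
    tableauTriangle (triangleTableau hμ ht hs) n = t := by
  refine MonotoneTriangle.ext_part fun i r hi => ?_
  rw [part_tableauTriangle _ hi]
  set T := triangleTableau hμ ht hs with hT
  have key : ∀ c, (r, c) ∈ μ → (c < rowLenLT T i r ↔ (c : ℤ) < t.part i r) := by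
    intro c hc
    rw [← lt_rowLenLT_iff T hc, ← triangleEntry_lt_iff hμ ht hs hc hi,
      show T r c = triangleEntry t r c from if_pos hc]
  have h0 := part_nonneg hμ ht hi r
  have h1 := part_mono hμ ht hs hi le_rfl r
  rw [part_bottom hμ ht] at h1
  rcases lt_trichotomy ((rowLenLT T i r : ℕ) : ℤ) (t.part i r) with h | h | h
  · have hm : (r, rowLenLT T i r) ∈ μ := YoungDiagram.mem_iff_lt_rowLen.mpr (by omega)
    exact absurd ((key _ hm).mpr h) (lt_irrefl _)
  · exact h
  · obtain ⟨c, hc⟩ := Int.eq_ofNat_of_zero_le h0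
    rw [hc] at h
    have hlt : c < rowLenLT T i r := by exact_mod_cast h
    have := (key c (mem_of_lt_rowLenLT T hlt)).mp hlt
    omega

end Part

theorem tableauTriangle_hasBottomRow {μ : YoungDiagram} {n : ℕ} {T : SemistandardYoungTableau μ}
    (hT : ∀ i j, (i, j) ∈ μ → T i j < n) :
    (tableauTriangle T n).HasBottomRow (shapeRow n μ) := by
  intro j
  simp only [tableauTriangle, shapeRow, Fin.val_rev]
  rw [if_pos (by omega)]
  have : rowLenLT T n (n - (j + 1)) = μ.rowLen (n - (j + 1)) := by
    rw [rowLenLT, Finset.filter_true_of_mem, Finset.card_range]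
    exact fun c hc => hT _ _ (YoungDiagram.mem_iff_lt_rowLen.mpr (Finset.mem_range.mp hc))
  rw [this]
  push_cast
  ring

theorem countSSYT_eq_countStrictMT (n : ℕ) (μ : YoungDiagram) (hμ : μ.colLen 0 ≤ n) :
    countSSYT n μ = countStrictMT n (shapeRow n μ) := by
  refine Nat.card_eq_of_bijective (fun T => ⟨tableauTriangle T.1 n,
    tableauTriangle_hasBottomRow T.2, tableauTriangle_strictSoutheast T.1 n⟩) ⟨?_, ?_⟩
  · rintro ⟨T, hT⟩ ⟨T', hT'⟩ h
    have h : tableauTriangle T n = tableauTriangle T' n := congrArg Subtype.val h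
    refine Subtype.ext (SemistandardYoungTableau.ext fun r c => ?_)
    by_cases hc : (r, c) ∈ μ
    -- Entries less than `n` are determined by their comparisons with all `i ≤ n`, and these
    -- comparisons can be read off from the triangle.
    · have key : ∀ i, i ≤ n → (T r c < i ↔ T' r c < i) := by
        intro i hi
        have h1 := part_tableauTriangle T hi r
        rw [h, part_tableauTriangle T' hi r, Nat.cast_inj] at h1
        rw [lt_rowLenLT_iff T hc, lt_rowLenLT_iff T' hc, h1]
      have h1 := hT r c hc
      have h2 := hT' r c hc
      have h3 := (key (T r c + 1) h1).mp (Nat.lt_add_one _)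
      have h4 := (key (T' r c + 1) h2).mpr (Nat.lt_add_one _)
      change T r c = T' r c
      omega
    · exact (T.zeros hc).trans (T'.zeros hc).symm
  · rintro ⟨t, ht, hs⟩
    refine ⟨⟨triangleTableau hμ ht hs, fun r c hc => ?_⟩,
      Subtype.ext (tableauTriangle_triangleTableau hμ ht hs)⟩
    rw [show triangleTableau hμ ht hs r c = triangleEntry t r c from if_pos hc]
    exact triangleEntry_lt hμ ht hs hc

end MonTri

open MonTri in
theorem mainTheorem2 (n : ℕ) (hn : 1 ≤ n) :
    -- the inverses in the formula exist
    (∀ p q : Fin n, p < q → IsUnit (factor (p, q))) ∧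
    -- the number of monotone triangles with bottom row `k`
    (∀ k : Fin n → ℤ, StrictMono k →
      (countMT n k : ℂ) = evalInt k (prodInvOp n (vandermonde n))) ∧
    -- the same formula for the extension `α(n; k)` to all integer tuples
    (∀ k : Fin n → ℤ, (alpha n k : ℂ) = evalInt k (prodInvOp n (vandermonde n))) ∧
    -- the enumeration is a polynomial `P`, unique and equal to `α(n; k)` on all of `ℤⁿ`;
    -- `prodOp n P` is the Vandermonde product, and it counts the strict patterns
    (∃! P : MvPolynomial (Fin n) ℂ,
      ∀ k : Fin n → ℤ, StrictMono k → evalInt k P = (countMT n k : ℂ)) ∧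
    (∀ P : MvPolynomial (Fin n) ℂ,
      (∀ k : Fin n → ℤ, StrictMono k → evalInt k P = (countMT n k : ℂ)) →
        (∀ k : Fin n → ℤ, evalInt k P = (alpha n k : ℂ)) ∧
        prodOp n P = vandermonde n ∧
        (∀ k : Fin n → ℤ, StrictMono k → evalInt k (prodOp n P) = (countStrictMT n k : ℂ)) ∧
        (∀ (k : Fin n → ℤ) (μ : YoungDiagram), μ.colLen 0 ≤ n →
          (∀ i : Fin n, k i = (μ.rowLen (i.rev : ℕ) : ℤ) + ((i : ℕ) + 1)) →
            evalInt k (prodOp n P) = (countSSYT n μ : ℂ))) := by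
  have hV : prodOp n (prodInvOp n (vandermonde n)) = vandermonde n := prodOp_prodInvOp_vandermonde n
  have hα : ∀ k : Fin n → ℤ, (alpha n k : ℂ) = evalInt k (prodInvOp n (vandermonde n)) := by
    obtain ⟨n, rfl⟩ := Nat.exists_eq_add_of_le' hn
    exact alpha_eq_evalInt n
  have hMT : ∀ k : Fin n → ℤ, StrictMono k →
      (countMT n k : ℂ) = evalInt k (prodInvOp n (vandermonde n)) := fun k hk => by
    rw [← hα, ← countMT_eq_alpha n k hk, Int.cast_natCast]
  have huniq : ∀ P : MvPolynomial (Fin n) ℂ,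
      (∀ k : Fin n → ℤ, StrictMono k → evalInt k P = (countMT n k : ℂ)) →
        P = prodInvOp n (vandermonde n) := fun P hP =>
    sub_eq_zero.mp (eq_zero_of_strictMono fun k hk => by
      rw [evalInt, map_sub]
      exact sub_eq_zero.mpr ((hP k hk).trans (hMT k hk)))
  have hstrict : ∀ k : Fin n → ℤ, StrictMono k →
      evalInt k (vandermonde n) = (countStrictMT n k : ℂ) := fun k hk => by
    rw [evalInt_vandermonde, ← countStrictMT_eq_chooseDet n k hk, Int.cast_natCast]
  refine ⟨fun p q _ => isUnit_factor (p, q), hMT, hα,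
    ⟨_, fun k hk => (hMT k hk).symm, huniq⟩, fun P hP => ?_⟩
  obtain rfl := huniq P hP
  rw [hV]
  refine ⟨fun k => (hα k).symm, rfl, hstrict, fun k μ hμ hk => ?_⟩
  obtain rfl : k = shapeRow n μ := funext hk
  rw [hstrict _ (strictMono_shapeRow n μ), countSSYT_eq_countStrictMT n μ hμ]
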